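/- **Model.** Let $G=(V,E)$ be a finite directed tree with a link $C\to D$ such that every node is either $C$ or an ancestor of $C$ ($k\ge C$), or $D$ or a descendant of $D$ ($k\le D$). Every $k\ge C$ has exactly one child and is either a source (no parents) or a coding point (at least two parents). Every $k\le D$ has exactly one parent and is either a receiver (no children) or a branching point (at least two children). $C$ is a coding point and $D$ is a branching point. Write $f(k)$ and $d(k)$ for the sets of parents and of children of $k$ (or for the single parent or child, when there is just one). Link $e$ works with probability $\alpha_e$, independently of the other links. Source $i$ sends the $i$-th binary unit vector, and every other node sends to its children the bit-wise XOR of the packets that reach it over working incoming links. An outcome $x=(x_a)_a$ lists the packets seen by the receivers $a$. $\Omega$ is the finite set of outcomes that can occur, and $p(x;\alpha)$ is the probability of $x$. Data are counts $n(x)\in\mathbb N$, $x\in\Omega$, with $n=\sum_{x\in\Omega} n(x)$ and $\hat p(x)=n(x)/n$. The likelihood is $\prod_{x\in\Omega}p(x;\alpha)^{n(x)}$, and $\mathcal L$ is its logarithm. An MLE is a maximizer of the likelihood over $(0,1]^E$. A solution of the likelihood equation is a point of $(0,1]^E$ at which $\mathcal L$ is finite and $\partial\mathcal L/\partial\alpha_e=0$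 for all $e\in E$. **Estimates.** For $k\ge C$, let $\hat\gamma^r_k$ be the sum of $\hat p(x)$ over the outcomes $x\in\Omega$ in which some receiver sees the probe of some source that is $k$ or an ancestor of $k$. For $k\le D$, let $\hat\gamma^m_k$ be the sum of $\hat p(x)$ over the $x\in\Omega$ in which some receiver that is $k$ or a descendant of $k$ sees a nonzero packet. Put $\hat A^r_k=\hat\gamma^r_k$ for sources and $\hat A^m_k=\hat\gamma^m_k$ for receivers. For every other $k\ge C$ (respectively $k\le D$), let $\hat A^r_k$ (respectively $\hat A^m_k$) be the solution $A\in[\hat\gamma^r_k,\infty)$ (respectively $A\in[\hat\gamma^m_k,\infty)$) of $$1-\frac{\hat\gamma^r_k}{A}=\prod_{j\in f(k)}\Bigl(1-\frac{\hat\gamma^r_j}{A}\Bigr),\qquad\text{respectively}\qquad 1-\frac{\hat\gamma^m_k}{A}=\prod_{j\in d(k)}\Bigl(1-\frac{\hat\gamma^m_j}{A}\Bigr).$$ Let $\hat\alpha\in\mathbb R^E$ have the entry $\hat A^r_k/\hat A^r_{d(k)}$ at the link that starts at $k>C$, the entry $\hat A^m_k/\hat A^m_{f(k)}$ at the link that ends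 at $k<D$, and $$\hat\alpha_{CD}=\frac{\hat A^r_C\,\hat A^m_D}{\hat\gamma^r_C}.$$ **Lemma.** (I) Suppose that $n(x)>0$ for every $x\in\Omega$. Then: 1. $\hat\gamma^r_C=\hat\gamma^m_D=1-\hat p(\mathbf 0)$, where $\mathbf 0$ is the all-zero outcome. 2. The solutions $\hat A^r_k$ and $\hat A^m_k$ above exist and are unique. 3. Every solution $\alpha$ of the likelihood equation is an MLE and has $\alpha_{CD}=\hat A^r_C\hat A^m_D/\hat\gamma^r_C$. 4. If $\hat\alpha_e\le 1$ for all $e\in E$ (so that $\hat\alpha\in(0,1]^E$), then $\hat\alpha$ solves the likelihood equation and is an MLE, and every MLE $\alpha$ has $\alpha_{CD}=\hat A^r_C\hat A^m_D/\hat\gamma^r_C$. (II) The conditions in (I) hold asymptotically: for every $\alpha\in(0,1)^E$ there is $\varepsilon>0$ such that, for all counts with $|\hat p(x)-p(x;\alpha)|<\varepsilon$ for every $x\in\Omega$, one has $n(x)>0$ for all $x\in\Omega$ and $\hat\alpha_e\le1$ for all $e\in E$. -/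

import Mathlib

open Relation Finset

/-- A directed logical tree with link `CD`: every node at or above `C` has exactly one child and is
either a source (no parent) or a coding point (at least two parents); every node at or below `D` has
exactly one parent and is either a receiver (no child) or a branching point (at least two children);
`C` is a coding point, `D` a branching point, and every node is of one of the two sorts. -/
structure TreeNetwork (V : Type*) where
  /-- `Link j k`: there is a directed link from `j` to `k`. -/
  Link : V → V → Prop
  C : V
  D : V
  isTree : (SimpleGraph.fromRel Link).IsTree
  link_CD : Link C D
  cover : ∀ k, ReflTransGen Link k C ∨ ReflTransGen Link D k
  upper_child : ∀ k, ReflTransGen Link k C → ∃! j, Link k j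
  upper_parents : ∀ k, ReflTransGen Link k C → (∀ j, ¬ Link j k) ∨ 2 ≤ {j | Link j k}.ncard
  lower_parent : ∀ k, ReflTransGen Link D k → ∃! j, Link j k
  lower_children : ∀ k, ReflTransGen Link D k → (∀ j, ¬ Link k j) ∨ 2 ≤ {j | Link k j}.ncard
  coding_C : 2 ≤ {j | Link j C}.ncard
  branching_D : 2 ≤ {j | Link D j}.ncard

namespace TreeNetwork

variable {V : Type*} (T : TreeNetwork V)

/-- `k ≥ C`: node `k` is `C` or an ancestor of `C`. -/
def Upper (k : V) : Prop := ReflTransGen T.Link k T.C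

/-- `k ≤ D`: node `k` is `D` or a descendant of `D`. -/
def Lower (k : V) : Prop := ReflTransGen T.Link T.D k

def IsSource (k : V) : Prop := ∀ j, ¬ T.Link j k

def IsReceiver (k : V) : Prop := ∀ j, ¬ T.Link k j

abbrev Source : Type _ := {k : V // T.IsSource k}

abbrev Receiver : Type _ := {k : V // T.IsReceiver k}

/-- The set `E` of links. -/
abbrev E : Type _ := {e : V × V // T.Link e.1 e.2}

/-- The link `CD`. -/
def CD : T.E := ⟨(T.C, T.D), T.link_CD⟩

theorem not_reach_D_C : ¬ ReflTransGen T.Link T.D T.C := by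
  intro h
  obtain ⟨c, _, hu⟩ := T.upper_child T.D h
  have h2 := T.branching_D
  have h1 : {j | T.Link T.D j} ⊆ {c} := fun j hj => hu j hj
  have h3 := Set.ncard_le_ncard h1 (Set.finite_singleton c)
  rw [Set.ncard_singleton] at h3
  omega

theorem acyclic (k : V) : ¬ TransGen T.Link k k := by
  intro hk
  rcases T.cover k with h | h
  · have key : TransGen T.Link T.C T.C := by
      induction h using ReflTransGen.head_induction_on with
      | refl => exact hk
      | @head a b hab hb ih =>
        apply ih
        obtain ⟨b', hab', hb'a⟩ := TransGen.head'_iff.1 hk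
        have hbb' : b' = b := (T.upper_child a (ReflTransGen.head hab hb)).unique hab' hab
        subst hbb'
        exact TransGen.tail'_iff.2 ⟨a, hb'a, hab⟩
    obtain ⟨b, hb, hbC⟩ := TransGen.head'_iff.1 key
    have : b = T.D := (T.upper_child T.C ReflTransGen.refl).unique hb T.link_CD
    subst this
    exact T.not_reach_D_C hbC
  · have key : TransGen T.Link T.D T.D := by
      induction h with
      | refl => exact hk
      | @tail b a hb hba ih =>
        apply ih
        obtain ⟨b', hab', hb'a⟩ := TransGen.tail'_iff.1 hk
        have hbb' : b' = b := (T.lower_parent a (ReflTransGen.tail hb hba)).unique hb'a hba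
        subst hbb'
        exact TransGen.head'_iff.2 ⟨a, hba, hab'⟩
    obtain ⟨b, hDb, hb⟩ := TransGen.tail'_iff.1 key
    have : b = T.C := (T.lower_parent T.D ReflTransGen.refl).unique hb T.link_CD
    subst this
    exact T.not_reach_D_C hDb

theorem wf [Finite V] : WellFounded T.Link := by
  have : Std.Irrefl (TransGen T.Link) := ⟨T.acyclic⟩
  exact Subrelation.wf (fun h => TransGen.single h)
    (Finite.wellFounded_of_trans_of_irrefl (TransGen T.Link))

noncomputable section

open scoped Classical

variable [Fintype V]

/-- The set `f(k)` of parents of `k`. -/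
def parents (k : V) : Finset V := univ.filter fun j => T.Link j k

/-- The set `d(k)` of children of `k`. -/
def children (k : V) : Finset V := univ.filter fun j => T.Link k j

/-- The packet `X_k`, a binary vector indexed by the sources, when `ω e` says whether link `e`
works: source `i` sends the `i`-th unit vector, and every other node sums (bit-wise XOR) the packets
that arrive on its working incoming links. -/
def packet (ω : T.E → Bool) : V → T.Source → ZMod 2 :=
  T.wf.fix fun k X =>
    if h : T.IsSource k then Pi.single ⟨k, h⟩ 1
    else ∑ j : {j : V // T.Link j k},
      if ω ⟨(j.1, k), j.2⟩ = true then X j.1 j.2 else 0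

theorem packet_eq (ω : T.E → Bool) (k : V) :
    T.packet ω k = if h : T.IsSource k then Pi.single ⟨k, h⟩ 1
      else ∑ j : {j : V // T.Link j k},
        if ω ⟨(j.1, k), j.2⟩ = true then T.packet ω j.1 else 0 := by
  unfold packet
  rw [WellFounded.fix_eq]

/-- One observed packet for every receiver. -/
abbrev Outcome : Type _ := T.Receiver → T.Source → ZMod 2

def outcome (ω : T.E → Bool) : T.Outcome := fun r => T.packet ω r.1

/-- The set of all outcomes that can be observed. -/
def Omega : Finset T.Outcome := univ.image T.outcome

/-- `p(x; α)`: the probability of the outcome `x` when the links work independently, link `e` with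
probability `α e`. -/
def prob (α : T.E → ℝ) (x : T.Outcome) : ℝ :=
  ∑ ω : T.E → Bool,
    if T.outcome ω = x then ∏ e, (if ω e = true then α e else 1 - α e) else 0

variable (n : T.Outcome → ℕ)

/-- The probability `∏ x, p(x; α) ^ n(x)` of the data. -/
def likelihood (α : T.E → ℝ) : ℝ := ∏ x ∈ T.Omega, T.prob α x ^ n x

def logLikelihood (α : T.E → ℝ) : ℝ := ∑ x ∈ T.Omega, (n x : ℝ) * Real.log (T.prob α x)

/-- The parameter space `(0, 1]^E`. -/
def Param : Set (T.E → ℝ) := {α | ∀ e, 0 < α e ∧ α e ≤ 1}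

/-- `α` is a maximum likelihood estimate. It is stated with the likelihood, not its logarithm, so
that the value `Real.log 0 = 0` plays no role. -/
def IsMLE (α : T.E → ℝ) : Prop := α ∈ T.Param ∧ IsMaxOn (T.likelihood n) T.Param α

/-- `α` solves the likelihood equation: the log-likelihood is finite at `α` and all its partial
derivatives exist and vanish there. -/
def SolvesLikelihoodEq (α : T.E → ℝ) : Prop :=
  α ∈ T.Param ∧ (∀ x ∈ T.Omega, 0 < T.prob α x) ∧
    ∀ e, HasDerivAt (fun t => T.logLikelihood n (Function.update α e t)) 0 (α e)

/-- The observed proportion of outcome `x`. -/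
def pHat (x : T.Outcome) : ℝ := (n x : ℝ) / ∑ y ∈ T.Omega, (n y : ℝ)

/-- `Ω^r(k)`: some receiver sees the probe of some source at or above `k`. -/
def OmegaR (k : V) : Finset T.Outcome :=
  T.Omega.filter fun x =>
    ∃ a : T.Receiver, ∃ j : T.Source, ReflTransGen T.Link j.1 k ∧ x a j ≠ 0

/-- `Ω^m(k)`: some receiver at or below `k` sees a nonzero packet. -/
def OmegaM (k : V) : Finset T.Outcome :=
  T.Omega.filter fun x => ∃ j : T.Receiver, ReflTransGen T.Link k j.1 ∧ x j ≠ 0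

def gammaR (k : V) : ℝ := ∑ x ∈ T.OmegaR k, T.pHat n x

def gammaM (k : V) : ℝ := ∑ x ∈ T.OmegaM k, T.pHat n x

/-- The equation for the estimate of the success probability from `k ≥ C` to the receiver of the
reduced reverse multicast tree. -/
def IsRootR (k : V) (A : ℝ) : Prop :=
  T.gammaR n k ≤ A ∧ 1 - T.gammaR n k / A = ∏ j ∈ T.parents k, (1 - T.gammaR n j / A)

/-- The equation for the estimate of the success probability from the source of the reduced
multicast tree to `k ≤ D`. -/
def IsRootM (k : V) (A : ℝ) : Prop :=
  T.gammaM n k ≤ A ∧ 1 - T.gammaM n k / A = ∏ j ∈ T.children k, (1 - T.gammaM n j / A)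

def AHatR (k : V) : ℝ :=
  if T.IsSource k then T.gammaR n k else Classical.epsilon (T.IsRootR n k)

def AHatM (k : V) : ℝ :=
  if T.IsReceiver k then T.gammaM n k else Classical.epsilon (T.IsRootM n k)

/-- The closed-form estimate of the success probability of link `CD`. -/
def alphaHatCD : ℝ := T.AHatR n T.C * T.AHatM n T.D / T.gammaR n T.C

/-- The vector of closed-form estimates: `Â^r_k / Â^r_{d(k)}` for the link that starts at `k > C`,
`Â^m_k / Â^m_{f(k)}` for the link that ends at `k < D`, and `alphaHatCD` for the link `CD`. -/
def alphaHat (e : T.E) : ℝ :=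
  if e = T.CD then T.alphaHatCD n
  else if T.Upper e.1.2 then T.AHatR n e.1.1 / T.AHatR n e.1.2
  else T.AHatM n e.1.2 / T.AHatM n e.1.1

end

end TreeNetwork

/-!
A nonzero outcome shows, for every node `k`, whether a probe crossed `k` (entered it on one side of
the link `CD` and left the network on the other). Its probability is a product over the links, and
the factor of a link depends on the outcome only through which of its two ends were crossed.
Hence the log-likelihood depends on the data only through the crossing proportions, and, taking the
links one by one from `CD` outwards, its partial derivatives vanish exactly when the crossing
probabilities of the model equal the observed crossing proportions. At such a point the observed
proportions can be replaced in the log-likelihood by the probabilities of the model, so Gibbs'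
inequality makes it a maximum likelihood estimate, and every other one gives the same probabilities.

The crossing probabilities `γ` determine the link parameters. One has `γ_k = A_k β_k`, where `A_k`
is the probability that `k` is joined to the other side and `β_k` that of reaching a source or
receiver beyond `k`. The recursion `1 - β_k = ∏ j, (1 - α_j β_j)` over the neighbours `j` beyond `k`
becomes the equation `1 - γ_k / A_k = ∏ j, (1 - γ_j / A_k)`, which has a single root because
`A (1 - ∏ j, (1 - γ_j / A))` is strictly increasing; the root is continuous in `γ`. Finally
`α_CD = A_C A_D / γ_C`.
-/

theorem mul_log_sub_log_le_sub {p q : ℝ} (hp : 0 < p) (hq : 0 < q) :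
    p * (Real.log q - Real.log p) ≤ q - p := by
  have h := mul_le_mul_of_nonneg_left (Real.log_le_sub_one_of_pos (div_pos hq hp)) hp.le
  rwa [Real.log_div hq.ne' hp.ne', mul_sub_one, mul_div_cancel₀ _ hp.ne'] at h

theorem eq_of_mul_log_sub_log_eq_sub {p q : ℝ} (hp : 0 < p) (hq : 0 < q)
    (h : p * (Real.log q - Real.log p) = q - p) : q = p := by
  by_contra hne
  have hlt := mul_lt_mul_of_pos_left (Real.log_lt_sub_one_of_pos (div_pos hq hp)
    fun h1 => hne (eq_of_div_eq_one h1)) hp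
  rw [Real.log_div hq.ne' hp.ne', mul_sub_one, mul_div_cancel₀ _ hp.ne'] at hlt
  exact hlt.ne h

section Gibbs

variable {ι : Type*} {s : Finset ι} {p q : ι → ℝ}

theorem sum_mul_log_le_sum_mul_log (hp : ∀ i ∈ s, 0 < p i) (hq : ∀ i ∈ s, 0 < q i)
    (hsum : ∑ i ∈ s, q i ≤ ∑ i ∈ s, p i) :
    ∑ i ∈ s, p i * Real.log (q i) ≤ ∑ i ∈ s, p i * Real.log (p i) := by
  have h := Finset.sum_le_sum fun i hi => mul_log_sub_log_le_sub (hp i hi) (hq i hi)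
  simp only [mul_sub, Finset.sum_sub_distrib] at h
  linarith

theorem eqOn_of_sum_mul_log_le (hp : ∀ i ∈ s, 0 < p i) (hq : ∀ i ∈ s, 0 < q i)
    (hsum : ∑ i ∈ s, q i ≤ ∑ i ∈ s, p i)
    (hlog : ∑ i ∈ s, p i * Real.log (p i) ≤ ∑ i ∈ s, p i * Real.log (q i)) :
    Set.EqOn q p s := by
  have hle : ∀ i ∈ s, p i * (Real.log (q i) - Real.log (p i)) ≤ q i - p i := fun i hi =>
    mul_log_sub_log_le_sub (hp i hi) (hq i hi)
  have hsum_eq : ∑ i ∈ s, p i * (Real.log (q i) - Real.log (p i)) = ∑ i ∈ s, (q i - p i) := by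
    refine le_antisymm (Finset.sum_le_sum hle) ?_
    simp only [mul_sub, Finset.sum_sub_distrib]
    linarith
  exact fun i hi => eq_of_mul_log_sub_log_eq_sub (hp i hi) (hq i hi)
    ((Finset.sum_eq_sum_iff_of_le hle).1 hsum_eq i hi)

/-- The expected score of a statistical model vanishes. -/
theorem hasDerivAt_sum_mul_log {f : ι → ℝ → ℝ} {t₀ c : ℝ}
    (hf : ∀ i ∈ s, DifferentiableAt ℝ (f i) t₀) (hpos : ∀ i ∈ s, f i t₀ ≠ 0)
    (hsum : ∀ t, ∑ i ∈ s, f i t = c) :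
    HasDerivAt (fun t => ∑ i ∈ s, f i t₀ * Real.log (f i t)) 0 t₀ := by
  have hderiv : ∑ i ∈ s, deriv (f i) t₀ = 0 := by
    have h := HasDerivAt.fun_sum fun i hi => (hf i hi).hasDerivAt
    simp only [hsum] at h
    exact h.unique (hasDerivAt_const t₀ c)
  have h : HasDerivAt (fun t => ∑ i ∈ s, f i t₀ * Real.log (f i t))
      (∑ i ∈ s, f i t₀ * (deriv (f i) t₀ / f i t₀)) t₀ :=
    HasDerivAt.fun_sum fun i hi => ((hf i hi).hasDerivAt.log (hpos i hi)).const_mul _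
  rwa [Finset.sum_congr rfl fun i hi => mul_div_cancel₀ _ (hpos i hi), hderiv] at h

end Gibbs

theorem eq_zero_of_hasDerivAt_mul_log_sub_log {a b c t₀ : ℝ} {f : ℝ → ℝ} (ht : 0 < t₀)
    (hb : 0 ≤ b) (htb : t₀ * b < 1)
    (hf : f =ᶠ[nhds t₀] fun t => a * (Real.log t - Real.log (1 - t * b)) + c)
    (hd : HasDerivAt f 0 t₀) : a = 0 := by
  have hlog := (((hasDerivAt_id t₀).mul_const b).const_sub 1).log (sub_pos.2 htb).ne'
  have h := ((((hasDerivAt_id t₀).log ht.ne').sub hlog).const_mul a).add_const c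
  have hderiv := (h.congr_of_eventuallyEq hf).unique hd
  have hpos : 0 < 1 / t₀ - -(1 * b) / (1 - t₀ * b) := by
    have := sub_pos.2 htb
    rw [neg_div, sub_neg_eq_add, one_mul]
    positivity
  exact (mul_eq_zero.1 hderiv).resolve_right hpos.ne'

theorem sum_ite_eq_ite_exists {ι M : Type*} [Fintype ι] [AddCommMonoid M] {P : ι → Prop}
    [DecidablePred P] [Decidable (∃ i, P i)] (hP : ∀ i j, P i → P j → i = j) (c : M) :
    ∑ i, (if P i then c else 0) = if ∃ i, P i then c else 0 := by
  split_ifs with h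
  · obtain ⟨i, hi⟩ := h
    rw [Finset.sum_eq_single i (fun j _ hne => if_neg fun hj => hne (hP j i hj hi)) (by simp),
      if_pos hi]
  · exact Finset.sum_eq_zero fun i _ => if_neg fun hi => h ⟨i, hi⟩

theorem dependsOn_of_imp {ι : Type*} {π : ι → Type*} {p : (∀ i, π i) → Prop} {A : Set ι}
    (h : ∀ x y, (∀ i ∈ A, x i = y i) → p x → p y) : DependsOn p A := fun x y hxy =>
  propext ⟨h x y hxy, h y x fun i hi => (hxy i hi).symm⟩

section Bernoulli

variable {ι κ R : Type*} [Fintype ι] [CommRing R]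

/-- The probability of `ω` when the coordinates are independent and coordinate `i` is `true` with
probability `α i`. The entries of `α` need not lie in `[0, 1]`, so that the weight can be
differentiated in `α` at the boundary of the unit cube. -/
def bernoulliWeight (α : ι → R) (ω : ι → Bool) : R := ∏ i, if ω i = true then α i else 1 - α i

open Classical in
/-- The probability of the event `p` under independent Bernoulli coordinates with parameters `α`;
see `bernoulliWeight`. -/
noncomputable def bernoulliProb (α : ι → R) (p : (ι → Bool) → Prop) : R :=
  ∑ ω with p ω, bernoulliWeight α ω

theorem bernoulliProb_eq_sum_filter [DecidableEq ι] (α : ι → R) (p : (ι → Bool) → Prop)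
    [DecidablePred p] : bernoulliProb α p = ∑ ω with p ω, bernoulliWeight α ω := by
  unfold bernoulliProb
  congr!

theorem sum_bernoulliWeight [DecidableEq ι] (α : ι → R) : ∑ ω, bernoulliWeight α ω = 1 := by
  have h := Finset.prod_univ_sum (fun _ : ι => (Finset.univ : Finset Bool))
    (fun i b => if b = true then α i else 1 - α i)
  rw [Fintype.piFinset_univ] at h
  simpa [bernoulliWeight] using h.symm

theorem bernoulliProb_eq_one (α : ι → R) {p : (ι → Bool) → Prop} (hp : ∀ ω, p ω) :
    bernoulliProb α p = 1 := by
  classical simp [bernoulliProb_eq_sum_filter, hp, sum_bernoulliWeight]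

theorem bernoulliProb_not (α : ι → R) (p : (ι → Bool) → Prop) :
    bernoulliProb α (fun ω => ¬ p ω) = 1 - bernoulliProb α p := by
  classical
  rw [eq_sub_iff_add_eq', ← sum_bernoulliWeight α]
  simp only [bernoulliProb_eq_sum_filter]
  exact Finset.sum_filter_add_sum_filter_not Finset.univ p (bernoulliWeight α)

theorem bernoulliProb_apply (α : ι → R) (i : ι) : bernoulliProb α (fun ω => ω i = true) = α i := by
  classical
  have hfilter : (Finset.univ.filter fun ω : ι → Bool => ω i = true) =
      Fintype.piFinset fun j => if j = i then {true} else Finset.univ := by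
    ext ω
    simp only [Finset.mem_filter, Finset.mem_univ, true_and, Fintype.mem_piFinset]
    refine ⟨fun h j => ?_, fun h => by simpa using h i⟩
    split_ifs with hj <;> simp [hj, h]
  simp only [bernoulliProb_eq_sum_filter, hfilter, bernoulliWeight]
  rw [← Finset.prod_univ_sum (fun j => if j = i then {true} else Finset.univ)
    fun j b => if b = true then α j else 1 - α j, Finset.prod_eq_single i]
  · simp
  · intro j _ hj
    simp [hj]
  · simp

theorem sum_bernoulliProb_eq (α : ι → R) (f : (ι → Bool) → κ) (s : Finset κ) :
    ∑ x ∈ s, bernoulliProb α (fun ω => f ω = x) = bernoulliProb α (fun ω => f ω ∈ s) := by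
  classical
  simp only [bernoulliProb_eq_sum_filter, Finset.sum_filter]
  rw [Finset.sum_comm]
  exact Finset.sum_congr rfl fun ω _ => by simp

theorem bernoulliProb_and (α : ι → R) {p q : (ι → Bool) → Prop} {A B : Set ι}
    (hp : DependsOn p A) (hq : DependsOn q B) (hAB : Disjoint A B) :
    bernoulliProb α (fun ω => p ω ∧ q ω) = bernoulliProb α p * bernoulliProb α q := by
  classical
  let swapOff : (ι → Bool) × (ι → Bool) → (ι → Bool) × (ι → Bool) := fun x =>
    (A.piecewise x.1 x.2, A.piecewise x.2 x.1)
  have hinvol : Function.Involutive swapOff := by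
    rintro ⟨a, b⟩
    ext i <;> by_cases hi : i ∈ A <;> simp [swapOff, hi]
  have hweight : ∀ x, bernoulliWeight α (swapOff x).1 * bernoulliWeight α (swapOff x).2 =
      bernoulliWeight α x.1 * bernoulliWeight α x.2 := by
    intro x
    simp only [bernoulliWeight, ← Finset.prod_mul_distrib]
    refine Finset.prod_congr rfl fun i _ => ?_
    by_cases hi : i ∈ A <;> simp [swapOff, hi, mul_comm]
  have hp' : ∀ x, p (swapOff x).1 = p x.1 := fun x => hp fun i hi => by simp [swapOff, hi]
  have hq' : ∀ x, q (swapOff x).2 = q x.1 := fun x => hq fun i hi => by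
    simp [swapOff, Set.disjoint_right.1 hAB hi]
  calc bernoulliProb α (fun ω => p ω ∧ q ω)
      = bernoulliProb α (fun ω => p ω ∧ q ω) * ∑ ω, bernoulliWeight α ω := by
        rw [sum_bernoulliWeight, mul_one]
    _ = ∑ x ∈ (Finset.univ.filter fun ω => p ω ∧ q ω) ×ˢ Finset.univ,
          bernoulliWeight α x.1 * bernoulliWeight α x.2 := by
        rw [bernoulliProb_eq_sum_filter, Finset.sum_mul_sum, Finset.sum_product]
    _ = ∑ x ∈ Finset.univ.filter p ×ˢ Finset.univ.filter q,
          bernoulliWeight α x.1 * bernoulliWeight α x.2 :=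
        Finset.sum_equiv hinvol.toPerm (fun x => by simp [hp', hq']) fun x _ => (hweight x).symm
    _ = bernoulliProb α p * bernoulliProb α q := by
        simp only [bernoulliProb_eq_sum_filter]
        rw [Finset.sum_mul_sum, Finset.sum_product]

theorem bernoulliProb_forall (α : ι → R) {s : Finset κ} {p : κ → (ι → Bool) → Prop}
    {A : κ → Set ι} (hp : ∀ j ∈ s, DependsOn (p j) (A j)) (hA : (s : Set κ).PairwiseDisjoint A) :
    bernoulliProb α (fun ω => ∀ j ∈ s, p j ω) = ∏ j ∈ s, bernoulliProb α (p j) := by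
  classical
  induction s using Finset.induction_on with
  | empty => simp [bernoulliProb_eq_one]
  | insert a s ha ih =>
    simp only [Finset.forall_mem_insert] at hp
    rw [Finset.coe_insert, Set.pairwiseDisjoint_insert_of_notMem (by simpa using ha)] at hA
    have hs : DependsOn (fun ω => ∀ j ∈ s, p j ω) (⋃ j ∈ s, A j) := fun ω ω' h =>
      propext <| forall₂_congr fun j hj =>
        iff_of_eq (hp.2 j hj fun i hi => h i (Set.mem_biUnion hj hi))
    simp only [Finset.forall_mem_insert]
    rw [bernoulliProb_and α hp.1 hs (Set.disjoint_iUnion₂_right.2 hA.2), ih hp.2 hA.1,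
      Finset.prod_insert ha]

end Bernoulli

section BernoulliReal

variable {ι : Type*} [Fintype ι] {α : ι → ℝ} {p : (ι → Bool) → Prop}

theorem differentiable_bernoulliProb (p : (ι → Bool) → Prop) :
    Differentiable ℝ fun α : ι → ℝ => bernoulliProb α p := by
  classical
  have hcont : ContDiff ℝ 1 fun α : ι → ℝ => bernoulliProb α p := by
    refine ContDiff.sum fun ω _ => contDiff_prod fun i _ => ?_
    split_ifs <;> fun_prop
  exact hcont.differentiable one_ne_zero

theorem bernoulliWeight_nonneg (h0 : ∀ i, 0 ≤ α i) (h1 : ∀ i, α i ≤ 1) (ω : ι → Bool) :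
    0 ≤ bernoulliWeight α ω := by
  refine Finset.prod_nonneg fun i _ => ?_
  split_ifs
  · exact h0 i
  · exact sub_nonneg.2 (h1 i)

theorem bernoulliProb_nonneg (h0 : ∀ i, 0 ≤ α i) (h1 : ∀ i, α i ≤ 1) (p : (ι → Bool) → Prop) :
    0 ≤ bernoulliProb α p :=
  Finset.sum_nonneg fun ω _ => bernoulliWeight_nonneg h0 h1 ω

theorem bernoulliProb_le_one (h0 : ∀ i, 0 ≤ α i) (h1 : ∀ i, α i ≤ 1) (p : (ι → Bool) → Prop) :
    bernoulliProb α p ≤ 1 := by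
  rw [← sub_nonneg, ← bernoulliProb_not]
  exact bernoulliProb_nonneg h0 h1 _

theorem bernoulliProb_pos (h0 : ∀ i, 0 < α i) (h1 : ∀ i, α i ≤ 1) (hp : p fun _ => true) :
    0 < bernoulliProb α p := by
  classical
  rw [bernoulliProb_eq_sum_filter]
  refine Finset.sum_pos' (fun ω _ => bernoulliWeight_nonneg (fun i => (h0 i).le) h1 ω)
    ⟨fun _ => true, by simpa using hp, ?_⟩
  exact Finset.prod_pos fun i _ => by simpa using h0 i

end BernoulliReal

open Filter Topology

section CrossingRoot

variable {ι : Type*}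

/-- The equation for the probability `A` of reaching a node, when a probe crosses the node with
probability `g` and crosses its neighbour `j ∈ s` on the far side with probability `c j`. -/
def IsCrossingRoot (g : ℝ) (s : Finset ι) (c : ι → ℝ) (A : ℝ) : Prop :=
  g ≤ A ∧ 1 - g / A = ∏ j ∈ s, (1 - c j / A)

/-- The inequalities between crossing probabilities under which `IsCrossingRoot` has exactly one
solution. -/
structure CrossingAdmissible (g : ℝ) (s : Finset ι) (c : ι → ℝ) : Prop where
  pos : 0 < g
  pos_of_mem : ∀ j ∈ s, 0 < c j
  lt_of_mem : ∀ j ∈ s, c j < g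
  lt_sum : g < ∑ j ∈ s, c j

/-- The probability of crossing a node that is reached with probability `A`; solving
`crossingFun s c A = g` for `A` is `IsCrossingRoot`. -/
noncomputable def crossingFun (s : Finset ι) (c : ι → ℝ) (A : ℝ) : ℝ :=
  A * (1 - ∏ j ∈ s, (1 - c j / A))

variable {g : ℝ} {s : Finset ι} {c : ι → ℝ} {A B : ℝ}

theorem isCrossingRoot_iff (hg : 0 < g) :
    IsCrossingRoot g s c A ↔ g ≤ A ∧ crossingFun s c A = g := by
  refine and_congr_right fun h => ?_
  have hA : A ≠ 0 := (hg.trans_le h).ne'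
  rw [crossingFun, mul_comm, ← eq_div_iff hA]
  constructor <;> intro h <;> linarith

theorem crossingFun_insert [DecidableEq ι] {a : ι} (ha : a ∉ s) (hA : A ≠ 0) :
    crossingFun (insert a s) c A = crossingFun s c A + c a * ∏ j ∈ s, (1 - c j / A) := by
  unfold crossingFun
  rw [Finset.prod_insert ha]
  field_simp
  ring

theorem one_sub_div_pos {x : ℝ} (hxA : x < A) (hA : 0 < A) : 0 < 1 - x / A :=
  sub_pos.2 ((div_lt_one hA).2 hxA)

theorem prod_one_sub_div_lt (hA : 0 < A) (hAB : A < B) (hc : ∀ j ∈ s, 0 < c j)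
    (hcA : ∀ j ∈ s, c j < A) (hs : s.Nonempty) :
    ∏ j ∈ s, (1 - c j / A) < ∏ j ∈ s, (1 - c j / B) :=
  Finset.prod_lt_prod_of_nonempty (fun j hj => one_sub_div_pos (hcA j hj) hA)
    (fun j hj => sub_lt_sub_left (div_lt_div_of_pos_left (hc j hj) hA hAB) 1) hs

theorem crossingFun_le_crossingFun (hA : 0 < A) (hAB : A < B) (hc : ∀ j ∈ s, 0 < c j)
    (hcA : ∀ j ∈ s, c j < A) : crossingFun s c A ≤ crossingFun s c B := by
  classical
  induction s using Finset.induction_on with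
  | empty => simp [crossingFun]
  | insert a s ha ih =>
    simp only [Finset.forall_mem_insert] at hc hcA
    rw [crossingFun_insert ha hA.ne', crossingFun_insert ha (hA.trans hAB).ne']
    refine add_le_add (ih hc.2 hcA.2) (mul_le_mul_of_nonneg_left ?_ hc.1.le)
    rcases s.eq_empty_or_nonempty with rfl | hs
    · simp
    · exact (prod_one_sub_div_lt hA hAB hc.2 hcA.2 hs).le

theorem crossingFun_lt_crossingFun (hA : 0 < A) (hAB : A < B) (hc : ∀ j ∈ s, 0 < c j)
    (hcA : ∀ j ∈ s, c j < A) (hs : s.Nontrivial) : crossingFun s c A < crossingFun s c B := by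
  classical
  obtain ⟨a, ha⟩ := hs.nonempty
  have hrest : (s.erase a).Nonempty := hs.erase_nonempty
  rw [← Finset.insert_erase ha] at hc hcA ⊢
  simp only [Finset.forall_mem_insert] at hc hcA
  rw [crossingFun_insert (s.notMem_erase a) hA.ne',
    crossingFun_insert (s.notMem_erase a) (hA.trans hAB).ne']
  exact add_lt_add_of_le_of_lt (crossingFun_le_crossingFun hA hAB hc.2 hcA.2)
    (mul_lt_mul_of_pos_left (prod_one_sub_div_lt hA hAB hc.2 hcA.2 hrest) hc.1)

theorem tendsto_crossingFun_atTop : Tendsto (crossingFun s c) atTop (𝓝 (∑ j ∈ s, c j)) := by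
  classical
  induction s using Finset.induction_on with
  | empty => simp [show crossingFun ∅ c = fun _ => 0 by ext; simp [crossingFun]]
  | insert a s ha ih =>
    have hprod : Tendsto (fun A => ∏ j ∈ s, (1 - c j / A)) atTop (𝓝 1) := by
      simpa using tendsto_finsetProd s fun j _ =>
        (tendsto_const_nhds (x := (1 : ℝ))).sub
          ((tendsto_const_nhds (x := c j)).div_atTop tendsto_id)
    rw [Finset.sum_insert ha, add_comm]
    refine Tendsto.congr' ?_ (by simpa using ih.add (hprod.const_mul (c a)))
    filter_upwards [eventually_ne_atTop 0] with A hA using (crossingFun_insert ha hA).symm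

theorem continuousOn_crossingFun : ContinuousOn (crossingFun s c) (Set.Ioi 0) := by
  refine continuousOn_id.mul (continuousOn_const.sub (continuousOn_finsetProd s fun j _ => ?_))
  exact continuousOn_const.sub (continuousOn_const.div continuousOn_id fun x hx => ne_of_gt hx)

namespace CrossingAdmissible

theorem nontrivial (h : CrossingAdmissible g s c) : s.Nontrivial := by
  by_contra hs
  rcases Finset.eq_empty_or_nonempty s with rfl | hne
  · exact lt_asymm h.pos (by simpa using h.lt_sum)
  · obtain ⟨a, rfl⟩ := (Finset.Nonempty.exists_eq_singleton_or_nontrivial hne).resolve_right hs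
    exact lt_asymm (h.lt_of_mem a (by simp)) (by simpa using h.lt_sum)

theorem strictMonoOn_crossingFun (h : CrossingAdmissible g s c) :
    StrictMonoOn (crossingFun s c) (Set.Ici g) := fun _ hA _ _ hAB =>
  crossingFun_lt_crossingFun (h.pos.trans_le hA) hAB h.pos_of_mem
    (fun j hj => (h.lt_of_mem j hj).trans_le hA) h.nontrivial

theorem crossingFun_self_lt (h : CrossingAdmissible g s c) : crossingFun s c g < g := by
  have hprod : 0 < ∏ j ∈ s, (1 - c j / g) :=
    Finset.prod_pos fun j hj => one_sub_div_pos (h.lt_of_mem j hj) h.pos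
  exact mul_lt_of_lt_one_right h.pos (sub_lt_self 1 hprod)

theorem existsUnique (h : CrossingAdmissible g s c) : ∃! A, IsCrossingRoot g s c A := by
  obtain ⟨B, hgB, hB⟩ := ((tendsto_crossingFun_atTop.eventually (lt_mem_nhds h.lt_sum)).and
    (eventually_ge_atTop g)).exists.imp fun _ hB => hB.symm
  have hcont : ContinuousOn (crossingFun s c) (Set.Icc g B) :=
    continuousOn_crossingFun.mono fun x hx => h.pos.trans_le hx.1
  obtain ⟨A, hA, hAg⟩ := intermediate_value_Icc hgB hcont ⟨h.crossingFun_self_lt.le, hB.le⟩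
  simp only [isCrossingRoot_iff h.pos]
  exact ⟨A, ⟨hA.1, hAg⟩, fun A' hA' =>
    h.strictMonoOn_crossingFun.injOn hA'.1 hA.1 (hA'.2.trans hAg.symm)⟩

theorem crossingFun_lt_iff (h : CrossingAdmissible g s c) (hA : IsCrossingRoot g s c A)
    (hB : g ≤ B) : crossingFun s c B < g ↔ B < A := by
  obtain ⟨hgA, hAg⟩ := (isCrossingRoot_iff h.pos).1 hA
  rw [← h.strictMonoOn_crossingFun.lt_iff_lt hB hgA, hAg]

theorem lt_crossingFun_iff (h : CrossingAdmissible g s c) (hA : IsCrossingRoot g s c A)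
    (hB : g ≤ B) : g < crossingFun s c B ↔ A < B := by
  obtain ⟨hgA, hAg⟩ := (isCrossingRoot_iff h.pos).1 hA
  rw [← h.strictMonoOn_crossingFun.lt_iff_lt hgA hB, hAg]

theorem lt_of_isCrossingRoot (h : CrossingAdmissible g s c) (hA : IsCrossingRoot g s c A) :
    g < A :=
  (h.crossingFun_lt_iff hA le_rfl).1 h.crossingFun_self_lt

variable {β : Type*} {l : Filter β} {g' : β → ℝ} {c' : β → ι → ℝ}

theorem eventually (h : CrossingAdmissible g s c) (hg : Tendsto g' l (𝓝 g))
    (hc : ∀ j ∈ s, Tendsto (fun b => c' b j) l (𝓝 (c j))) :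
    ∀ᶠ b in l, CrossingAdmissible (g' b) s (c' b) := by
  filter_upwards [hg.eventually (lt_mem_nhds h.pos),
    (Finset.eventually_all s).2 fun j hj =>
      (hc j hj).eventually (lt_mem_nhds (h.pos_of_mem j hj)),
    (Finset.eventually_all s).2 fun j hj => (hc j hj).eventually_lt hg (h.lt_of_mem j hj),
    hg.eventually_lt (tendsto_finsetSum s hc) h.lt_sum]
    with b hpos hpos_of_mem hlt_of_mem hlt_sum
  exact ⟨hpos, hpos_of_mem, hlt_of_mem, hlt_sum⟩

theorem tendsto_root (h : CrossingAdmissible g s c) (hg : Tendsto g' l (𝓝 g))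
    (hc : ∀ j ∈ s, Tendsto (fun b => c' b j) l (𝓝 (c j))) (hA : IsCrossingRoot g s c A)
    {A' : β → ℝ} (hA' : ∀ᶠ b in l, IsCrossingRoot (g' b) s (c' b) (A' b)) :
    Tendsto A' l (𝓝 A) := by
  have hgA := h.lt_of_isCrossingRoot hA
  have hfun : ∀ B, Tendsto (fun b => crossingFun s (c' b) B) l (𝓝 (crossingFun s c B)) := fun B =>
    tendsto_const_nhds.mul (tendsto_const_nhds.sub (tendsto_finsetProd s fun j hj =>
      tendsto_const_nhds.sub ((hc j hj).div_const B)))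
  rw [tendsto_order]
  constructor
  · intro a ha
    obtain ⟨B, hB, hBA⟩ := exists_between (max_lt ha hgA)
    obtain ⟨haB, hgB⟩ := max_lt_iff.1 hB
    filter_upwards [(hfun B).eventually_lt hg ((h.crossingFun_lt_iff hA hgB.le).2 hBA),
      h.eventually hg hc, hA', hg.eventually (gt_mem_nhds hgB)] with b hb hadm hroot hgb
    exact haB.trans ((hadm.crossingFun_lt_iff hroot hgb.le).1 hb)
  · intro B hAB
    have hgB := hgA.trans hAB
    filter_upwards [hg.eventually_lt (hfun B) ((h.lt_crossingFun_iff hA hgB.le).2 hAB),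
      h.eventually hg hc, hA', hg.eventually (gt_mem_nhds hgB)] with b hb hadm hroot hgb
    exact (hadm.lt_crossingFun_iff hroot hgb.le).1 hb

end CrossingAdmissible

end CrossingRoot

theorem exists_forall_abs_sub_lt_of_eventually_nhds {ι : Type*} {s : Finset ι} {p : ι → ℝ}
    {P : (ι → ℝ) → Prop} (h : ∀ᶠ w in 𝓝 p, P w)
    (hcongr : ∀ w w', Set.EqOn w w' s → P w → P w') :
    ∃ ε > 0, ∀ w : ι → ℝ, (∀ i ∈ s, |w i - p i| < ε) → P w := by
  classical
  let extend (v : s → ℝ) (i : ι) : ℝ := if hi : i ∈ s then v ⟨i, hi⟩ else p i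
  have hcont : Continuous extend := continuous_pi fun i => by
    by_cases hi : i ∈ s
    · simpa only [extend, dif_pos hi] using continuous_apply _
    · simpa only [extend, dif_neg hi] using continuous_const
  have hextend : extend (fun i => p i) = p := funext fun i => dite_eq_right_iff.2 fun _ => rfl
  have hP : ∀ᶠ v in 𝓝 fun i : s => p i, P (extend v) :=
    hcont.continuousAt.eventually (by rwa [hextend])
  obtain ⟨ε, hε, hball⟩ := Metric.eventually_nhds_iff.1 hP
  refine ⟨ε, hε, fun w hw => hcongr (extend fun i => w i) w (fun i hi => dif_pos hi)
    (hball ((dist_pi_lt_iff hε).2 fun i => hw i i.2))⟩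

namespace TreeNetwork

variable {V : Type*} {T : TreeNetwork V} {i j k p : V} {ω : T.E → Bool}

theorem upper_C : T.Upper T.C := ReflTransGen.refl

theorem lower_D : T.Lower T.D := ReflTransGen.refl

theorem Upper.not_lower (h : T.Upper k) : ¬ T.Lower k := fun h' =>
  T.not_reach_D_C (ReflTransGen.trans h' h)

theorem Lower.not_upper (h : T.Lower k) : ¬ T.Upper k := fun h' => h'.not_lower h

theorem lower_of_not_upper (h : ¬ T.Upper k) : T.Lower k := (T.cover k).resolve_left h

section Inward

variable (T)

open Classical in
/-- The neighbour of `k` on the side of the link `CD`: the child of `k ≥ C` and the parent of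
`k ≤ D`. In particular `C` and `D` are the inward neighbours of each other. -/
noncomputable def inward (k : V) : V :=
  if h : T.Upper k then (T.upper_child k h).choose
  else (T.lower_parent k (lower_of_not_upper h)).choose

/-- `j ∉ {C, D}` is a neighbour of `k` on the side away from the link `CD`: a parent of `k ≥ C` or a
child of `k ≤ D`. Removing the link `CD` leaves two trees, with roots `C` and `D`, and this is the
relation of a node to the next nodes further from the root. -/
def Outward (k j : V) : Prop := j ≠ T.C ∧ j ≠ T.D ∧ T.inward j = k

/-- `j` is `k` or lies beyond `k` as seen from the link `CD`. -/
def Behind (k j : V) : Prop := ReflTransGen T.Outward k j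

/-- `k` is a source or a receiver. -/
def IsLeaf (k : V) : Prop := ∀ j, ¬ T.Outward k j

open Classical in
/-- The end, `C` or `D`, of the link `CD` that is on the side of `k`. -/
noncomputable def root (k : V) : V := if T.Upper k then T.C else T.D

variable {T}

theorem Upper.link_iff (h : T.Upper k) : T.Link k j ↔ j = T.inward k := by
  have hspec := (T.upper_child k h).choose_spec
  simp only [inward, h, dite_true]
  exact ⟨hspec.2 j, fun hj => hj ▸ hspec.1⟩

theorem Lower.link_iff (h : T.Lower k) : T.Link j k ↔ j = T.inward k := by
  have hspec := (T.lower_parent k h).choose_spec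
  simp only [inward, h.not_upper, dite_false]
  exact ⟨hspec.2 j, fun hj => hj ▸ hspec.1⟩

theorem inward_C : T.inward T.C = T.D := (upper_C.link_iff.1 T.link_CD).symm

theorem inward_D : T.inward T.D = T.C := (lower_D.link_iff.1 T.link_CD).symm

theorem Upper.inward (h : T.Upper k) (hC : k ≠ T.C) : T.Upper (T.inward k) := by
  obtain ⟨p, hkp, hp⟩ := (ReflTransGen.cases_head h).resolve_left hC
  exact h.link_iff.1 hkp ▸ hp

theorem Lower.inward (h : T.Lower k) (hD : k ≠ T.D) : T.Lower (T.inward k) := by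
  obtain ⟨p, hp, hpk⟩ := (ReflTransGen.cases_tail h).resolve_left hD
  exact h.link_iff.1 hpk ▸ hp

theorem Outward.upper_iff (h : T.Outward k j) : T.Upper j ↔ T.Upper k := by
  obtain ⟨hC, hD, rfl⟩ := h
  refine ⟨fun hj => hj.inward hC, fun hk => ?_⟩
  by_contra hj
  exact hk.not_lower ((lower_of_not_upper hj).inward hD)

theorem Upper.outward_iff (hk : T.Upper k) : T.Outward k j ↔ T.Link j k := by
  constructor
  · exact fun h => (h.upper_iff.2 hk).link_iff.2 h.2.2.symm
  · intro h
    have hj : T.Upper j := ReflTransGen.head h hk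
    refine ⟨?_, ?_, (hj.link_iff.1 h).symm⟩
    · rintro rfl
      exact hk.not_lower (upper_C.link_iff.1 h ▸ inward_C ▸ lower_D)
    · rintro rfl
      exact hj.not_lower lower_D

theorem Lower.outward_iff (hk : T.Lower k) : T.Outward k j ↔ T.Link k j := by
  constructor
  · intro h
    have hj : T.Lower j := lower_of_not_upper (mt h.upper_iff.1 hk.not_upper)
    exact hj.link_iff.2 h.2.2.symm
  · intro h
    have hj : T.Lower j := ReflTransGen.tail hk h
    refine ⟨?_, ?_, (hj.link_iff.1 h).symm⟩
    · rintro rfl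
      exact upper_C.not_lower hj
    · rintro rfl
      exact hk.not_upper (lower_D.link_iff.1 h ▸ inward_D ▸ upper_C)

theorem Behind.upper_iff (h : T.Behind k j) : T.Upper j ↔ T.Upper k := by
  induction h with
  | refl => rfl
  | tail _ h ih => rw [h.upper_iff, ih]

theorem Upper.behind_iff (hk : T.Upper k) : T.Behind k j ↔ ReflTransGen T.Link j k := by
  constructor <;> intro h
  · induction h with
    | refl => exact .refl
    | tail hb hbc ih =>
      exact ReflTransGen.head ((((Behind.upper_iff hb).2 hk).outward_iff).1 hbc) ih
  · induction h using ReflTransGen.head_induction_on with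
    | refl => exact .refl
    | head hab _ ih => exact ReflTransGen.tail ih ((((Behind.upper_iff ih).2 hk).outward_iff).2 hab)

theorem Lower.behind_iff (hk : T.Lower k) : T.Behind k j ↔ ReflTransGen T.Link k j := by
  have hlower : ∀ {i}, T.Behind k i → T.Lower i := fun h =>
    lower_of_not_upper (mt (Behind.upper_iff h).1 hk.not_upper)
  constructor <;> intro h
  · induction h with
    | refl => exact .refl
    | tail hb hbc ih => exact ReflTransGen.tail ih ((hlower hb).outward_iff.1 hbc)
  · induction h with
    | refl => exact .refl
    | tail _ hbc ih => exact ReflTransGen.tail ih ((hlower ih).outward_iff.2 hbc)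

theorem Upper.isLeaf_iff (h : T.Upper k) : T.IsLeaf k ↔ T.IsSource k := by
  simp only [IsLeaf, IsSource, h.outward_iff]

theorem Lower.isLeaf_iff (h : T.Lower k) : T.IsLeaf k ↔ T.IsReceiver k := by
  simp only [IsLeaf, IsReceiver, h.outward_iff]

theorem IsSource.upper (h : T.IsSource k) : T.Upper k := by
  by_contra hk
  obtain ⟨p, hp, -⟩ := T.lower_parent k (lower_of_not_upper hk)
  exact h p hp

theorem IsReceiver.lower (h : T.IsReceiver k) : T.Lower k := by
  by_contra hk
  obtain ⟨p, hp, -⟩ := T.upper_child k ((T.cover k).resolve_right hk)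
  exact h p hp

theorem IsSource.isLeaf (h : T.IsSource k) : T.IsLeaf k := h.upper.isLeaf_iff.2 h

theorem IsReceiver.isLeaf (h : T.IsReceiver k) : T.IsLeaf k := h.lower.isLeaf_iff.2 h

theorem two_le_ncard_outward (h : ¬ T.IsLeaf k) : 2 ≤ {j | T.Outward k j}.ncard := by
  by_cases hk : T.Upper k
  · simp_rw [hk.outward_iff]
    exact (T.upper_parents k hk).resolve_left (mt hk.isLeaf_iff.2 h)
  · have hk := lower_of_not_upper hk
    simp_rw [hk.outward_iff]
    exact (T.lower_children k hk).resolve_left (mt hk.isLeaf_iff.2 h)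

theorem not_transGen_outward (k : V) : ¬ TransGen T.Outward k k := by
  intro h
  obtain ⟨j, hj, hjk⟩ := TransGen.tail'_iff.1 h
  by_cases hk : T.Upper k
  · have hj' := (Behind.upper_iff hj).2 hk
    exact T.acyclic k (TransGen.head' (hj'.outward_iff.1 hjk) (hk.behind_iff.1 hj))
  · have hj' := lower_of_not_upper (mt (Behind.upper_iff hj).1 hk)
    exact T.acyclic k (TransGen.tail' ((lower_of_not_upper hk).behind_iff.1 hj)
      (hj'.outward_iff.1 hjk))

theorem wellFounded_outward_swap [Finite V] : WellFounded (Function.swap T.Outward) := by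
  have : Std.Irrefl (TransGen (Function.swap T.Outward)) :=
    ⟨fun k h => not_transGen_outward (T := T) k (transGen_swap.1 h)⟩
  exact Subrelation.wf (r := TransGen (Function.swap T.Outward)) (fun h => TransGen.single h)
    (Finite.wellFounded_of_trans_of_irrefl _)

theorem exists_isLeaf_behind [Finite V] (k : V) : ∃ l, T.IsLeaf l ∧ T.Behind k l := by
  induction k using (wellFounded_outward_swap (T := T)).induction with
  | _ k ih =>
    by_cases hk : T.IsLeaf k
    · exact ⟨k, hk, .refl⟩
    · obtain ⟨j, hj⟩ : ∃ j, T.Outward k j := by simpa only [IsLeaf, not_forall, not_not] using hk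
      obtain ⟨l, hl, hjl⟩ := ih j hj
      exact ⟨l, hl, ReflTransGen.head hj hjl⟩

theorem Behind.total (hi : T.Behind i k) (hj : T.Behind j k) : T.Behind i j ∨ T.Behind j i := by
  have h := ReflTransGen.total_of_right_unique (r := Function.swap T.Outward)
    (fun _ _ _ hab hac => hab.2.2.symm.trans hac.2.2) (reflTransGen_swap.2 hi)
    (reflTransGen_swap.2 hj)
  exact (h.imp reflTransGen_swap.1 reflTransGen_swap.1).symm

theorem eq_of_outward_of_behind {j' : V} (h : T.Outward k j) (h' : T.Outward k j')
    (hi : T.Behind j i) (hi' : T.Behind j' i) : j = j' := by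
  have eq_of_behind : ∀ {a b : V}, T.Outward k a → T.Outward k b → T.Behind a b → a = b := by
    intro a b ha hb hab
    rcases ReflTransGen.cases_tail hab with hba | ⟨p, hap, hpb⟩
    · exact hba.symm
    · obtain rfl : k = p := hb.2.2.symm.trans hpb.2.2
      exact absurd (TransGen.head' ha hap) (not_transGen_outward k)
  rcases hi.total hi' with hjj' | hj'j
  · exact eq_of_behind h h' hjj'
  · exact (eq_of_behind h' h hj'j).symm

theorem root_of_upper (h : T.Upper k) : T.root k = T.C := by simp only [root, h, if_true]

theorem root_of_lower (h : T.Lower k) : T.root k = T.D := by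
  simp only [root, h.not_upper, if_false]

theorem root_C : T.root T.C = T.C := root_of_upper upper_C

theorem root_D : T.root T.D = T.D := root_of_lower lower_D

theorem root_eq_C_or_D (k : V) : T.root k = T.C ∨ T.root k = T.D :=
  (em (T.Upper k)).imp root_of_upper fun h => root_of_lower (lower_of_not_upper h)

theorem Behind.root_eq (h : T.Behind k j) : T.root j = T.root k := by
  unfold root
  rw [h.upper_iff]

theorem Outward.root_eq (h : T.Outward k j) : T.root j = T.root k :=
  Behind.root_eq (ReflTransGen.single h)

theorem behind_root (k : V) : T.Behind (T.root k) k := by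
  by_cases h : T.Upper k
  · rw [root_of_upper h]
    exact upper_C.behind_iff.2 h
  · rw [root_of_lower (lower_of_not_upper h)]
    exact lower_D.behind_iff.2 (lower_of_not_upper h)

theorem outward_induction {P : V → Prop} (hroot : ∀ k, P (T.root k))
    (houtward : ∀ k j, T.Outward k j → P k → P j) (k : V) : P k := by
  have hbehind : ∀ {j}, T.Behind (T.root k) j → P j := fun h => by
    induction h with
    | refl => exact hroot k
    | tail _ h ih => exact houtward _ _ h ih
  exact hbehind (behind_root k)

theorem root_root (k : V) : T.root (T.root k) = T.root k :=
  (behind_root k).root_eq.symm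

theorem not_outward_root : ¬ T.Outward p (T.root k) := fun h =>
  (root_eq_C_or_D k).elim h.1 h.2.1

theorem root_inward_root_ne (k : V) : T.root (T.inward (T.root k)) ≠ T.root k := by
  have hne : T.C ≠ T.D := fun h => upper_C.not_lower (h ▸ lower_D)
  rcases root_eq_C_or_D k with h | h <;> rw [h]
  · rw [inward_C, root_D]
    exact hne.symm
  · rw [inward_D, root_C]
    exact hne

end Inward

section InwardLink

variable (T)

open Classical in
/-- The link between `k` and its inward neighbour. Every link other than `CD` is that of exactly one
node, while `CD` is that of both `C` and `D`. -/
noncomputable def inwardLink (k : V) : T.E :=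
  if h : T.Upper k then ⟨(k, T.inward k), h.link_iff.2 rfl⟩
  else ⟨(T.inward k, k), (lower_of_not_upper h).link_iff.2 rfl⟩

/-- The links beyond `k` as seen from the link `CD`. -/
def linksBehind (k : V) : Set T.E := T.inwardLink '' {j | TransGen T.Outward k j}

variable {T}

theorem inwardLink_of_upper (h : T.Upper k) :
    T.inwardLink k = ⟨(k, T.inward k), h.link_iff.2 rfl⟩ := dif_pos h

theorem inwardLink_of_lower (h : T.Lower k) :
    T.inwardLink k = ⟨(T.inward k, k), h.link_iff.2 rfl⟩ := dif_neg h.not_upper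

theorem inwardLink_C : T.inwardLink T.C = T.CD := by
  simp only [inwardLink_of_upper upper_C, inward_C, CD]

theorem inwardLink_D : T.inwardLink T.D = T.CD := by
  simp only [inwardLink_of_lower lower_D, inward_D, CD]

theorem inwardLink_root (k : V) : T.inwardLink (T.root k) = T.CD := by
  rcases root_eq_C_or_D k with h | h <;> rw [h]
  exacts [inwardLink_C, inwardLink_D]

theorem inwardLink_eq_iff (h : T.Outward p k) : T.inwardLink j = T.inwardLink k ↔ j = k := by
  refine ⟨fun he => ?_, fun he => he ▸ rfl⟩
  by_cases hk : T.Upper k <;> by_cases hj : T.Upper j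
  · rw [inwardLink_of_upper hk, inwardLink_of_upper hj] at he
    exact congrArg (fun e : T.E => e.1.1) he
  · rw [inwardLink_of_upper hk, inwardLink_of_lower (lower_of_not_upper hj)] at he
    have hjp : j = T.inward k := congrArg (fun e : T.E => e.1.2) he
    exact absurd (hjp ▸ hk.inward h.1) hj
  · have hk := lower_of_not_upper hk
    rw [inwardLink_of_lower hk, inwardLink_of_upper hj] at he
    have hjp : j = T.inward k := congrArg (fun e : T.E => e.1.1) he
    exact absurd hj (hjp ▸ hk.inward h.2.1).not_upper
  · rw [inwardLink_of_lower (lower_of_not_upper hk),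
      inwardLink_of_lower (lower_of_not_upper hj)] at he
    exact congrArg (fun e : T.E => e.1.2) he

theorem inwardLink_ne_CD (h : T.Outward p k) : T.inwardLink k ≠ T.CD := by
  rw [← inwardLink_C, ne_eq, eq_comm, inwardLink_eq_iff h]
  exact h.1.symm

theorem exists_inwardLink_eq {e : T.E} (he : e ≠ T.CD) :
    ∃ p k, T.Outward p k ∧ T.inwardLink k = e := by
  obtain ⟨⟨a, b⟩, hab⟩ := e
  by_cases hb : T.Upper b
  · have ha : T.Upper a := ReflTransGen.head hab hb
    refine ⟨b, a, hb.outward_iff.2 hab, ?_⟩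
    simp only [inwardLink_of_upper ha, ← ha.link_iff.1 hab]
  · have hb := lower_of_not_upper hb
    have hba := hb.link_iff.1 hab
    have hbD : b ≠ T.D := by
      rintro rfl
      obtain rfl : a = T.C := hba.trans inward_D
      exact he rfl
    have ha : T.Lower a := by simpa only [← hba] using hb.inward hbD
    refine ⟨a, b, ha.outward_iff.2 hab, ?_⟩
    simp only [inwardLink_of_lower hb, ← hba]

theorem forall_link_iff {P : T.E → Prop} :
    (∀ e, P e) ↔ P T.CD ∧ ∀ k j, T.Outward k j → P (T.inwardLink j) := by
  refine ⟨fun h => ⟨h _, fun _ _ _ => h _⟩, fun ⟨hCD, hlink⟩ e => ?_⟩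
  by_cases he : e = T.CD
  · exact he ▸ hCD
  · obtain ⟨k, j, hkj, rfl⟩ := exists_inwardLink_eq he
    exact hlink k j hkj

theorem exists_outward_of_transGen (h : TransGen T.Outward k j) : ∃ p, T.Outward p j := by
  obtain ⟨p, -, hp⟩ := TransGen.tail'_iff.1 h
  exact ⟨p, hp⟩

theorem inwardLink_mem_linksBehind_iff (h : T.Outward p j) :
    T.inwardLink j ∈ T.linksBehind k ↔ TransGen T.Outward k j := by
  refine ⟨?_, fun hj => ⟨j, hj, rfl⟩⟩
  rintro ⟨i, hi, hij⟩
  exact (inwardLink_eq_iff h).1 hij ▸ hi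

theorem CD_notMem_linksBehind : T.CD ∉ T.linksBehind k := by
  rintro ⟨i, hi, hiCD⟩
  obtain ⟨p, hp⟩ := exists_outward_of_transGen hi
  exact inwardLink_ne_CD hp hiCD

theorem inwardLink_notMem_linksBehind (k : V) : T.inwardLink k ∉ T.linksBehind k := by
  rintro ⟨i, hi, hik⟩
  obtain ⟨p, hp⟩ := exists_outward_of_transGen hi
  exact not_transGen_outward i ((inwardLink_eq_iff hp).1 hik.symm ▸ hi)

theorem inwardLink_mem_linksBehind (h : T.Outward k j) : T.inwardLink j ∈ T.linksBehind k :=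
  ⟨j, TransGen.single h, rfl⟩

theorem linksBehind_subset (h : T.Outward k j) : T.linksBehind j ⊆ T.linksBehind k :=
  Set.image_mono fun _ hi => TransGen.head h hi

theorem disjoint_linksBehind (h : ∀ i, T.Behind j i → ¬ T.Behind k i) :
    Disjoint (T.linksBehind j) (T.linksBehind k) := by
  rw [Set.disjoint_left]
  rintro _ ⟨i, hji, rfl⟩ hk
  obtain ⟨p, hp⟩ := exists_outward_of_transGen hji
  exact h i hji.to_reflTransGen ((inwardLink_mem_linksBehind_iff hp).1 hk).to_reflTransGen

theorem inwardLink_mem_insert_linksBehind_iff (h : T.Outward p j) :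
    T.inwardLink j ∈ insert (T.inwardLink k) (T.linksBehind k) ↔ T.Behind k j := by
  rw [Set.mem_insert_iff, eq_comm, inwardLink_eq_iff h, inwardLink_mem_linksBehind_iff h, Behind,
    reflTransGen_iff_eq_or_transGen, eq_comm]

theorem disjoint_insert_linksBehind {p' j' : V} (h : T.Outward p j) (h' : T.Outward p' j')
    (hbehind : ∀ i, T.Behind j i → ¬ T.Behind j' i) :
    Disjoint (insert (T.inwardLink j) (T.linksBehind j))
      (insert (T.inwardLink j') (T.linksBehind j')) := by
  rw [Set.disjoint_insert_left, Set.disjoint_insert_right, inwardLink_mem_insert_linksBehind_iff h,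
    inwardLink_mem_linksBehind_iff h']
  exact ⟨hbehind j .refl, fun hj' => hbehind j' hj'.to_reflTransGen .refl,
    disjoint_linksBehind hbehind⟩

theorem disjoint_linksBehind_inward_root (k : V) :
    Disjoint (T.linksBehind (T.inward (T.root k))) (T.linksBehind (T.root k)) :=
  disjoint_linksBehind fun i hi hi' => root_inward_root_ne k
    (by rw [← hi.root_eq, hi'.root_eq, root_root])

end InwardLink

section Crossed

variable (T) (ω)

/-- All links on the path from `k` outward to `j` work. -/
def OpenPath (k j : V) : Prop :=
  ReflTransGen (fun a b => T.Outward a b ∧ ω (T.inwardLink b) = true) k j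

/-- A working path leads from `k` outward to some leaf. -/
def ReachesLeaf (k : V) : Prop := ∃ l, T.IsLeaf l ∧ T.OpenPath ω k l

/-- A working path joins `k` through the link `CD` to some leaf on the other side. For `k ≥ C` a
packet at `k` then reaches a receiver; for `k ≤ D` some probe reaches `k`. -/
def Joined (k : V) : Prop :=
  ω T.CD = true ∧ T.OpenPath ω (T.root k) k ∧ T.ReachesLeaf ω (T.inward (T.root k))

/-- A probe passes through `k` from some source to some receiver. -/
def Crossed (k : V) : Prop := T.Joined ω k ∧ T.ReachesLeaf ω k

variable {T} {ω}

theorem OpenPath.behind (h : T.OpenPath ω k j) : T.Behind k j :=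
  ReflTransGen.mono (fun _ _ => And.left) k j h

theorem openPath_iff_of_outward (h : T.Outward p j) (hne : k ≠ j) :
    T.OpenPath ω k j ↔ ω (T.inwardLink j) = true ∧ T.OpenPath ω k p := by
  constructor
  · intro ho
    obtain ⟨b, hkb, hb, hω⟩ := (ReflTransGen.cases_tail ho).resolve_left hne.symm
    obtain rfl : b = p := hb.2.2.symm.trans h.2.2
    exact ⟨hω, hkb⟩
  · exact fun ⟨hω, hkp⟩ => ReflTransGen.tail hkp ⟨h, hω⟩

theorem openPath_iff_of_isLeaf (h : T.IsLeaf k) : T.OpenPath ω k j ↔ j = k := by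
  refine ⟨fun ho => ?_, fun hj => hj ▸ .refl⟩
  rcases ReflTransGen.cases_head ho with hkj | ⟨b, hb, -⟩
  · exact hkj.symm
  · exact absurd hb.1 (h b)

theorem openPath_iff_exists_outward (hne : k ≠ j) :
    T.OpenPath ω k j ↔ ∃ i, T.Outward k i ∧ ω (T.inwardLink i) = true ∧ T.OpenPath ω i j := by
  constructor
  · intro ho
    obtain ⟨i, hi, hij⟩ := (ReflTransGen.cases_head ho).resolve_left hne
    exact ⟨i, hi.1, hi.2, hij⟩
  · exact fun ⟨i, hki, hω, hij⟩ => ReflTransGen.head ⟨hki, hω⟩ hij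

theorem IsLeaf.reachesLeaf (h : T.IsLeaf k) : T.ReachesLeaf ω k := ⟨k, h, .refl⟩

theorem OpenPath.reachesLeaf (h : T.OpenPath ω k j) (hj : T.ReachesLeaf ω j) :
    T.ReachesLeaf ω k := by
  obtain ⟨l, hl, hjl⟩ := hj
  exact ⟨l, hl, ReflTransGen.trans h hjl⟩

theorem reachesLeaf_iff (h : ¬ T.IsLeaf k) :
    T.ReachesLeaf ω k ↔ ∃ j, T.Outward k j ∧ ω (T.inwardLink j) = true ∧ T.ReachesLeaf ω j := by
  constructor
  · rintro ⟨l, hl, hkl⟩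
    obtain ⟨j, hkj, hω, hjl⟩ := (openPath_iff_exists_outward (by rintro rfl; exact h hl)).1 hkl
    exact ⟨j, hkj, hω, l, hl, hjl⟩
  · exact fun ⟨j, hkj, hω, hj⟩ => OpenPath.reachesLeaf (ReflTransGen.single ⟨hkj, hω⟩) hj

theorem joined_root_iff :
    T.Joined ω (T.root k) ↔ ω T.CD = true ∧ T.ReachesLeaf ω (T.inward (T.root k)) := by
  simp only [Joined, root_root]
  exact and_congr_right fun _ => and_iff_right .refl

theorem joined_iff_of_outward (h : T.Outward p j) :
    T.Joined ω j ↔ ω (T.inwardLink j) = true ∧ T.Joined ω p := by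
  unfold Joined
  rw [h.root_eq, openPath_iff_of_outward h fun he => not_outward_root (he ▸ h)]
  tauto

theorem OpenPath.joined (h : T.OpenPath ω k j) (hk : T.Joined ω k) : T.Joined ω j := by
  induction h with
  | refl => exact hk
  | tail _ h ih => exact (joined_iff_of_outward h.1).2 ⟨h.2, ih⟩

theorem IsLeaf.crossed_iff (h : T.IsLeaf k) : T.Crossed ω k ↔ T.Joined ω k :=
  and_iff_left h.reachesLeaf

theorem Crossed.of_behind (h : T.Behind k j) (hj : T.Crossed ω j) : T.Crossed ω k := by
  induction h with
  | refl => exact hj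
  | tail _ h ih =>
    obtain ⟨hω, hb⟩ := (joined_iff_of_outward h).1 hj.1
    exact ih ⟨hb, OpenPath.reachesLeaf (ReflTransGen.single ⟨h, hω⟩) hj.2⟩

theorem Crossed.exists_isLeaf (h : T.Crossed ω k) :
    ∃ l, T.IsLeaf l ∧ T.Behind k l ∧ T.Crossed ω l := by
  obtain ⟨hk, l, hl, hkl⟩ := h
  exact ⟨l, hl, hkl.behind, hl.crossed_iff.2 (hkl.joined hk)⟩

theorem crossed_C_iff :
    T.Crossed ω T.C ↔ ω T.CD = true ∧ T.ReachesLeaf ω T.C ∧ T.ReachesLeaf ω T.D := by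
  have h := joined_root_iff (T := T) (ω := ω) (k := T.C)
  rw [root_C, inward_C] at h
  rw [Crossed, h]
  tauto

theorem crossed_D_iff : T.Crossed ω T.D ↔ T.Crossed ω T.C := by
  have h := joined_root_iff (T := T) (ω := ω) (k := T.D)
  rw [root_D, inward_D] at h
  rw [crossed_C_iff, Crossed, h]
  tauto

theorem crossed_root_iff : T.Crossed ω (T.root k) ↔ T.Crossed ω T.C := by
  rcases root_eq_C_or_D k with h | h <;> rw [h]
  exact crossed_D_iff

theorem Crossed.crossed_C (h : T.Crossed ω k) : T.Crossed ω T.C :=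
  crossed_root_iff.1 (h.of_behind (behind_root k))

theorem Crossed.exists_source (h : T.Crossed ω k) (hk : T.Upper k) :
    ∃ s : T.Source, ReflTransGen T.Link s k ∧ T.Crossed ω s := by
  obtain ⟨l, hl, hkl, hcross⟩ := h.exists_isLeaf
  exact ⟨⟨l, ((Behind.upper_iff hkl).2 hk).isLeaf_iff.1 hl⟩, hk.behind_iff.1 hkl, hcross⟩

theorem Crossed.exists_receiver (h : T.Crossed ω k) (hk : T.Lower k) :
    ∃ a : T.Receiver, ReflTransGen T.Link k a ∧ T.Crossed ω a := by
  obtain ⟨l, hl, hkl, hcross⟩ := h.exists_isLeaf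
  have hlower := lower_of_not_upper (mt (Behind.upper_iff hkl).1 hk.not_upper)
  exact ⟨⟨l, hlower.isLeaf_iff.1 hl⟩, hk.behind_iff.1 hkl, hcross⟩

end Crossed

noncomputable section ObservedCrossings

open scoped Classical

variable [Fintype V]

theorem packet_of_upper (hk : T.Upper k) (s : T.Source) :
    T.packet ω k s = if T.OpenPath ω k s then 1 else 0 := by
  induction k using T.wf.induction with
  | _ k ih =>
    rw [T.packet_eq]
    by_cases hsource : T.IsSource k
    · rw [dif_pos hsource, Pi.single_apply]
      simp only [openPath_iff_of_isLeaf hsource.isLeaf, Subtype.ext_iff]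
    · have hterm : ∀ j : {j : V // T.Link j k},
          (if ω ⟨(j.1, k), j.2⟩ = true then T.packet ω j.1 else 0) s =
            if ω (T.inwardLink j.1) = true ∧ T.OpenPath ω j.1 s then 1 else 0 := by
        rintro ⟨j, hjk⟩
        have hj : T.Upper j := ReflTransGen.head hjk hk
        rw [ite_apply, ih j hjk hj, ite_and, inwardLink_of_upper hj]
        simp only [← hj.link_iff.1 hjk, Pi.zero_apply]
      have hunique : ∀ i j : {j : V // T.Link j k},
          (ω (T.inwardLink i.1) = true ∧ T.OpenPath ω i.1 s) →
          (ω (T.inwardLink j.1) = true ∧ T.OpenPath ω j.1 s) → i = j := fun i j hi hj =>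
        Subtype.ext (eq_of_outward_of_behind (hk.outward_iff.2 i.2) (hk.outward_iff.2 j.2)
          hi.2.behind hj.2.behind)
      rw [dif_neg hsource, Finset.sum_apply, Finset.sum_congr rfl fun j _ => hterm j,
        sum_ite_eq_ite_exists (P := fun j : {j : V // T.Link j k} =>
          ω (T.inwardLink j.1) = true ∧ T.OpenPath ω j.1 s) hunique]
      have hks : k ≠ s := by
        rintro rfl
        exact hsource s.2
      simp only [openPath_iff_exists_outward hks, hk.outward_iff, Subtype.exists, exists_prop]

theorem packet_eq_of_link (hk : T.Lower k) (hp : T.Link p k) :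
    T.packet ω k = if ω (T.inwardLink k) = true then T.packet ω p else 0 := by
  have hparent := hk.link_iff.1 hp
  rw [T.packet_eq, dif_neg fun h => h p hp, inwardLink_of_lower hk,
    Fintype.sum_eq_single ⟨p, hp⟩ fun j hj => absurd (Subtype.ext
      ((hk.link_iff.1 j.2).trans hparent.symm)) hj]
  simp only [← hparent]

theorem packet_of_lower (hk : T.Lower k) :
    T.packet ω k = if ω T.CD = true ∧ T.OpenPath ω T.D k then T.packet ω T.C else 0 := by
  induction hk with
  | refl =>
    rw [packet_eq_of_link lower_D T.link_CD, inwardLink_D]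
    simp only [and_iff_left (show T.OpenPath ω T.D T.D from .refl)]
  | @tail p k hp hpk ih =>
    have hp : T.Lower p := hp
    have ho : T.Outward p k := hp.outward_iff.2 hpk
    rw [packet_eq_of_link (ReflTransGen.tail hp hpk) hpk, ih,
      openPath_iff_of_outward ho (Ne.symm ho.2.1), ← ite_and]
    congr! 1
    exact and_left_comm

theorem outcome_apply (ω : T.E → Bool) (a : T.Receiver) (s : T.Source) :
    T.outcome ω a s = if T.Crossed ω a ∧ T.Crossed ω s then 1 else 0 := by
  have ha := IsReceiver.lower a.2
  have hs := IsSource.upper s.2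
  have hiff : T.Crossed ω a ∧ T.Crossed ω s ↔
      (ω T.CD = true ∧ T.OpenPath ω T.D a) ∧ T.OpenPath ω T.C s := by
    rw [(IsReceiver.isLeaf a.2).crossed_iff, (IsSource.isLeaf s.2).crossed_iff, Joined, Joined,
      root_of_lower ha, root_of_upper hs, inward_C, inward_D]
    exact ⟨fun h => ⟨⟨h.1.1, h.1.2.1⟩, h.2.2.1⟩, fun h =>
      ⟨⟨h.1.1, h.1.2, s, IsSource.isLeaf s.2, h.2⟩, h.1.1, h.2, a, IsReceiver.isLeaf a.2, h.1.2⟩⟩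
  rw [outcome, packet_of_lower ha, ite_apply, packet_of_upper upper_C]
  simp only [hiff, ite_and, Pi.zero_apply]

theorem outcome_eq_outcome {ω' : T.E → Bool}
    (h : ∀ l, T.IsLeaf l → (T.Crossed ω l ↔ T.Crossed ω' l)) : T.outcome ω = T.outcome ω' := by
  ext a s
  simp only [outcome_apply, h _ (IsReceiver.isLeaf a.2), h _ (IsSource.isLeaf s.2)]

theorem outcome_apply_ne_zero_iff (a : T.Receiver) (s : T.Source) :
    T.outcome ω a s ≠ 0 ↔ T.Crossed ω a ∧ T.Crossed ω s := by
  simp only [outcome_apply, ne_eq, ite_eq_right_iff, one_ne_zero, imp_false, not_not]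

theorem outcome_mem_Omega (ω : T.E → Bool) : T.outcome ω ∈ T.Omega :=
  Finset.mem_image_of_mem _ (Finset.mem_univ ω)

theorem mem_Omega {x : T.Outcome} : x ∈ T.Omega ↔ ∃ ω, T.outcome ω = x := by
  simp only [Omega, Finset.mem_image, Finset.mem_univ, true_and]

theorem outcome_mem_OmegaR_iff (hk : T.Upper k) : T.outcome ω ∈ T.OmegaR k ↔ T.Crossed ω k := by
  simp only [OmegaR, Finset.mem_filter, outcome_mem_Omega, true_and, outcome_apply_ne_zero_iff]
  constructor
  · rintro ⟨-, s, hs, -, hcross⟩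
    exact hcross.of_behind (hk.behind_iff.2 hs)
  · intro h
    obtain ⟨s, hs, hs'⟩ := h.exists_source hk
    obtain ⟨a, -, ha⟩ := (crossed_D_iff.2 h.crossed_C).exists_receiver lower_D
    exact ⟨a, s, hs, ha, hs'⟩

theorem outcome_mem_OmegaM_iff (hk : T.Lower k) : T.outcome ω ∈ T.OmegaM k ↔ T.Crossed ω k := by
  simp only [OmegaM, Finset.mem_filter, outcome_mem_Omega, true_and, Function.ne_iff,
    Pi.zero_apply, outcome_apply_ne_zero_iff]
  constructor
  · rintro ⟨a, ha, s, hcross, -⟩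
    exact hcross.of_behind (hk.behind_iff.2 ha)
  · intro h
    obtain ⟨a, ha, ha'⟩ := h.exists_receiver hk
    obtain ⟨s, -, hs⟩ := h.crossed_C.exists_source upper_C
    exact ⟨a, ha, s, ha', hs⟩

variable (T)

/-- The outcomes that show that a probe crossed `k`: `OmegaR k` for `k ≥ C` and `OmegaM k` for
`k ≤ D`. -/
def OmegaAt (k : V) : Finset T.Outcome := if T.Upper k then T.OmegaR k else T.OmegaM k

variable {T}

theorem OmegaAt_of_upper (h : T.Upper k) : T.OmegaAt k = T.OmegaR k := if_pos h

theorem OmegaAt_of_lower (h : T.Lower k) : T.OmegaAt k = T.OmegaM k := if_neg h.not_upper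

theorem OmegaAt_subset_Omega (k : V) : T.OmegaAt k ⊆ T.Omega := by
  unfold OmegaAt
  split_ifs <;> exact Finset.filter_subset _ _

theorem outcome_mem_OmegaAt_iff : T.outcome ω ∈ T.OmegaAt k ↔ T.Crossed ω k := by
  by_cases hk : T.Upper k
  · rw [OmegaAt_of_upper hk, outcome_mem_OmegaR_iff hk]
  · have hk := lower_of_not_upper hk
    rw [OmegaAt_of_lower hk, outcome_mem_OmegaM_iff hk]

theorem OmegaAt_subset_OmegaAt (h : ∀ ω, T.Crossed ω j → T.Crossed ω k) :
    T.OmegaAt j ⊆ T.OmegaAt k := by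
  intro x hx
  obtain ⟨ω, rfl⟩ := mem_Omega.1 (OmegaAt_subset_Omega j hx)
  exact outcome_mem_OmegaAt_iff.2 (h ω (outcome_mem_OmegaAt_iff.1 hx))

theorem OmegaAt_subset_of_behind (h : T.Behind k j) : T.OmegaAt j ⊆ T.OmegaAt k :=
  OmegaAt_subset_OmegaAt fun _ hj => hj.of_behind h

theorem OmegaAt_subset_OmegaAt_C (k : V) : T.OmegaAt k ⊆ T.OmegaAt T.C :=
  OmegaAt_subset_OmegaAt fun _ => Crossed.crossed_C

theorem OmegaAt_root (k : V) : T.OmegaAt (T.root k) = T.OmegaAt T.C :=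
  (OmegaAt_subset_OmegaAt_C _).antisymm (OmegaAt_subset_OmegaAt fun _ => crossed_root_iff.2)

theorem mem_OmegaAt_C_iff {x : T.Outcome} : x ∈ T.OmegaAt T.C ↔ x ∈ T.Omega ∧ x ≠ 0 := by
  have hlower : ∀ a : T.Receiver, ReflTransGen T.Link T.D a := fun a => IsReceiver.lower a.2
  rw [← OmegaAt_root T.D, root_D, OmegaAt_of_lower lower_D]
  simp only [OmegaM, Finset.mem_filter, hlower, true_and, Function.ne_iff (f₁ := x),
    Pi.zero_apply]

end ObservedCrossings

section DependsOn

theorem dependsOn_apply_inwardLink (k : V) :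
    DependsOn (fun ω : T.E → Bool => ω (T.inwardLink k) = true) {T.inwardLink k} :=
  dependsOn_of_imp fun _ _ h => (h _ rfl).symm.trans

theorem dependsOn_reachesLeaf (k : V) :
    DependsOn (fun ω => T.ReachesLeaf ω k) (T.linksBehind k) := by
  refine dependsOn_of_imp fun ω ω' h ⟨l, hl, hkl⟩ => ⟨l, hl, ?_⟩
  clear hl
  induction hkl with
  | refl => exact .refl
  | @tail b c hkb hbc ih =>
    refine ReflTransGen.tail ih ⟨hbc.1, ?_⟩
    rw [← h _ ⟨c, TransGen.tail' (OpenPath.behind hkb) hbc.1, rfl⟩]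
    exact hbc.2

theorem dependsOn_inwardLink_and_reachesLeaf (k : V) :
    DependsOn (fun ω => ω (T.inwardLink k) = true ∧ T.ReachesLeaf ω k)
      (insert (T.inwardLink k) (T.linksBehind k)) := fun _ _ h =>
  congrArg₂ And (dependsOn_apply_inwardLink k fun e he => h e (Or.inl he))
    (dependsOn_reachesLeaf k fun e he => h e (Or.inr he))

theorem dependsOn_joined (k : V) : DependsOn (fun ω => T.Joined ω k) (T.linksBehind k)ᶜ := by
  induction k using outward_induction (T := T) with
  | hroot k =>
    simp only [joined_root_iff, ← inwardLink_root k]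
    refine fun _ _ h => congrArg₂ And (dependsOn_apply_inwardLink _ fun e he => h e ?_)
      (dependsOn_reachesLeaf _ fun e he => h e ?_)
    · obtain rfl : e = T.inwardLink (T.root k) := he
      exact inwardLink_notMem_linksBehind _
    · exact Set.disjoint_left.1 (disjoint_linksBehind_inward_root k) he
  | houtward k j hkj ih =>
    simp only [joined_iff_of_outward hkj]
    refine fun _ _ h => congrArg₂ And (dependsOn_apply_inwardLink j fun e he => h e ?_)
      (ih fun e he => h e (mt (@linksBehind_subset _ T _ _ hkj e) he))
    obtain rfl : e = T.inwardLink j := he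
    exact inwardLink_notMem_linksBehind j

end DependsOn

noncomputable section Probabilities

open scoped Classical

variable [Fintype V]

section CrossingProbabilities

variable (T) (α : T.E → ℝ)

/-- The neighbours of `k` on the side away from the link `CD`. -/
def outwardNbrs (k : V) : Finset V := univ.filter fun j => T.Outward k j

/-- The probability that a working path leads from `k` outward to some leaf. -/
def reachesLeafProb (k : V) : ℝ := bernoulliProb α fun ω => T.ReachesLeaf ω k

/-- The probability, written `A_k`, that `k` is joined through the link `CD` to some leaf on the
other side. -/
def joinedProb (k : V) : ℝ := bernoulliProb α fun ω => T.Joined ω k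

/-- The probability, written `γ_k`, that some probe passes through `k` to some receiver. -/
def crossedProb (k : V) : ℝ := bernoulliProb α fun ω => T.Crossed ω k

variable {T} {α}

theorem mem_outwardNbrs : j ∈ T.outwardNbrs k ↔ T.Outward k j := by
  simp only [outwardNbrs, Finset.mem_filter, Finset.mem_univ, true_and]

theorem two_le_card_outwardNbrs (h : ¬ T.IsLeaf k) : 2 ≤ (T.outwardNbrs k).card := by
  have hcard := two_le_ncard_outward h
  rwa [Set.ncard_eq_toFinset_card', Set.toFinset_ofPred] at hcard

theorem reachesLeafProb_of_isLeaf (h : T.IsLeaf k) : T.reachesLeafProb α k = 1 :=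
  bernoulliProb_eq_one α fun _ => h.reachesLeaf

theorem bernoulliProb_inwardLink_and_reachesLeaf (α : T.E → ℝ) (k : V) :
    bernoulliProb α (fun ω => ω (T.inwardLink k) = true ∧ T.ReachesLeaf ω k) =
      α (T.inwardLink k) * T.reachesLeafProb α k := by
  rw [bernoulliProb_and α (dependsOn_apply_inwardLink k) (dependsOn_reachesLeaf k)
    (Set.disjoint_singleton_left.2 (inwardLink_notMem_linksBehind k)), bernoulliProb_apply,
    reachesLeafProb]

theorem one_sub_reachesLeafProb (α : T.E → ℝ) (h : ¬ T.IsLeaf k) :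
    1 - T.reachesLeafProb α k =
      ∏ j ∈ T.outwardNbrs k, (1 - α (T.inwardLink j) * T.reachesLeafProb α j) := by
  have hnot : ∀ ω, ¬ T.ReachesLeaf ω k ↔
      ∀ j ∈ T.outwardNbrs k, ¬ (ω (T.inwardLink j) = true ∧ T.ReachesLeaf ω j) := fun ω => by
    simp only [reachesLeaf_iff h, mem_outwardNbrs, not_exists, not_and]
  rw [reachesLeafProb, ← bernoulliProb_not]
  simp only [hnot]
  rw [bernoulliProb_forall α (s := T.outwardNbrs k)
    (p := fun j ω => ¬ (ω (T.inwardLink j) = true ∧ T.ReachesLeaf ω j))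
    (A := fun j => insert (T.inwardLink j) (T.linksBehind j))]
  · simp only [bernoulliProb_not, bernoulliProb_inwardLink_and_reachesLeaf]
  · exact fun j _ _ _ h => congrArg Not (dependsOn_inwardLink_and_reachesLeaf j h)
  · intro j hj j' hj' hne
    have hkj := mem_outwardNbrs.1 hj
    have hkj' := mem_outwardNbrs.1 hj'
    exact disjoint_insert_linksBehind hkj hkj' fun i hi hi' =>
      hne (eq_of_outward_of_behind hkj hkj' hi hi')

theorem crossedProb_eq_mul (α : T.E → ℝ) (k : V) :
    T.crossedProb α k = T.joinedProb α k * T.reachesLeafProb α k :=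
  bernoulliProb_and α (dependsOn_joined k) (dependsOn_reachesLeaf k) disjoint_compl_left

theorem joinedProb_root (α : T.E → ℝ) (k : V) : T.joinedProb α (T.root k) =
    α T.CD * T.reachesLeafProb α (T.inward (T.root k)) := by
  simp only [joinedProb, joined_root_iff, ← inwardLink_root k]
  rw [bernoulliProb_and α (dependsOn_apply_inwardLink (T.root k)) (dependsOn_reachesLeaf _),
    bernoulliProb_apply, reachesLeafProb]
  rw [inwardLink_root, Set.disjoint_singleton_left]
  exact CD_notMem_linksBehind

theorem joinedProb_of_outward (α : T.E → ℝ) (h : T.Outward k j) :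
    T.joinedProb α j = α (T.inwardLink j) * T.joinedProb α k := by
  simp only [joinedProb, joined_iff_of_outward h]
  rw [bernoulliProb_and α (dependsOn_apply_inwardLink j) (dependsOn_joined k)
    (Set.disjoint_singleton_left.2 fun hj => hj (inwardLink_mem_linksBehind h)),
    bernoulliProb_apply]

theorem joinedProb_C (α : T.E → ℝ) :
    T.joinedProb α T.C = α T.CD * T.reachesLeafProb α T.D := by
  simpa only [root_C, inward_C] using joinedProb_root α T.C

theorem joinedProb_D (α : T.E → ℝ) :
    T.joinedProb α T.D = α T.CD * T.reachesLeafProb α T.C := by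
  simpa only [root_D, inward_D] using joinedProb_root α T.D

theorem crossedProb_of_outward (α : T.E → ℝ) (h : T.Outward k j) : T.crossedProb α j =
    T.joinedProb α k * (α (T.inwardLink j) * T.reachesLeafProb α j) := by
  rw [crossedProb_eq_mul, joinedProb_of_outward α h]
  ring

theorem crossedProb_of_isLeaf (α : T.E → ℝ) (h : T.IsLeaf k) :
    T.crossedProb α k = T.joinedProb α k := by
  rw [crossedProb_eq_mul, reachesLeafProb_of_isLeaf h, mul_one]

end CrossingProbabilities

section OutcomeProbability

variable (T)

/-- The nodes other than `C` and `D`. They index the links other than `CD` through `inwardLink`. -/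
def outerNodes : Finset V := univ.filter fun j => j ≠ T.C ∧ j ≠ T.D

/-- What the outcome `x` says about `ω` on the part of the network that starts with the link inward
of `j`: if `x` shows a probe crossing `j`, then that link works; if `x` shows a probe crossing the
inward neighbour but not `j`, then no working path leads from that neighbour through `j` to a
leaf. -/
def LinkFits (x : T.Outcome) (j : V) (ω : T.E → Bool) : Prop :=
  (x ∈ T.OmegaAt j → ω (T.inwardLink j) = true) ∧
    (x ∉ T.OmegaAt j → x ∈ T.OmegaAt (T.inward j) →
      ¬ (ω (T.inwardLink j) = true ∧ T.ReachesLeaf ω j))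

/-- The links that `LinkFits x j` refers to. -/
def fittedLinks (x : T.Outcome) (j : V) : Set T.E :=
  if x ∈ T.OmegaAt j then {T.inwardLink j}
  else if x ∈ T.OmegaAt (T.inward j) then insert (T.inwardLink j) (T.linksBehind j)
  else ∅

variable {T}

theorem mem_outerNodes : j ∈ T.outerNodes ↔ T.Outward (T.inward j) j := by
  simp only [outerNodes, Outward, Finset.mem_filter, Finset.mem_univ, true_and, and_true]

theorem Outward.mem_outerNodes (h : T.Outward k j) : j ∈ T.outerNodes :=
  TreeNetwork.mem_outerNodes.2 (h.2.2 ▸ h)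

theorem linkFits_outcome (h : T.Outward (T.inward j) j) (ω : T.E → Bool) :
    T.LinkFits (T.outcome ω) j ω := by
  simp only [LinkFits, outcome_mem_OmegaAt_iff]
  exact ⟨fun hj => ((joined_iff_of_outward h).1 hj.1).1, fun hj hk hω =>
    hj ⟨(joined_iff_of_outward h).2 ⟨hω.1, hk.1⟩, hω.2⟩⟩

section FitsImpliesEq

variable {ω₀ : T.E → Bool} (hfit : ∀ j ∈ T.outerNodes, T.LinkFits (T.outcome ω₀) j ω)
include hfit

theorem openPath_of_linkFits (k : V) : T.Crossed ω₀ k → T.OpenPath ω (T.root k) k := by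
  induction k using outward_induction (T := T) with
  | hroot k =>
    rw [root_root]
    exact fun _ => .refl
  | houtward k j hkj ih =>
    intro hj
    rw [hkj.root_eq, openPath_iff_of_outward hkj fun h => not_outward_root (h ▸ hkj)]
    exact ⟨(hfit j hkj.mem_outerNodes).1 (outcome_mem_OmegaAt_iff.2 hj),
      ih (hj.of_behind (ReflTransGen.single hkj))⟩

theorem reachesLeaf_root_of_linkFits (h : T.Crossed ω₀ T.C) (k : V) :
    T.ReachesLeaf ω (T.root k) := by
  obtain ⟨l, hl, hkl, hcross⟩ := (crossed_root_iff.2 h : T.Crossed ω₀ (T.root k)).exists_isLeaf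
  refine ⟨l, hl, ?_⟩
  have hpath := openPath_of_linkFits hfit l hcross
  rwa [hkl.root_eq, root_root] at hpath

theorem crossed_of_linkFits (h : T.Crossed ω₀ T.C) (k : V) :
    T.Crossed ω k → T.Crossed ω₀ k := by
  induction k using outward_induction (T := T) with
  | hroot k => exact fun _ => crossed_root_iff.2 h
  | houtward k j hkj ih =>
    intro hj
    by_contra hj₀
    have hk₀ := ih (hj.of_behind (ReflTransGen.single hkj))
    refine (hfit j hkj.mem_outerNodes).2 (mt outcome_mem_OmegaAt_iff.1 hj₀) ?_
      ⟨((joined_iff_of_outward hkj).1 hj.1).1, hj.2⟩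
    rw [hkj.2.2]
    exact outcome_mem_OmegaAt_iff.2 hk₀

theorem outcome_eq_of_linkFits (hCD : ω T.CD = true) (h : T.Crossed ω₀ T.C) :
    T.outcome ω = T.outcome ω₀ := by
  have hC : T.ReachesLeaf ω T.C := root_C (T := T) ▸ reachesLeaf_root_of_linkFits hfit h T.C
  have hD : T.ReachesLeaf ω T.D := root_D (T := T) ▸ reachesLeaf_root_of_linkFits hfit h T.D
  have hcross : T.Crossed ω T.C := crossed_C_iff.2 ⟨hCD, hC, hD⟩
  refine outcome_eq_outcome fun l hl => ⟨crossed_of_linkFits hfit h l, fun hl₀ => ?_⟩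
  exact hl.crossed_iff.2 ((openPath_of_linkFits hfit l hl₀).joined (crossed_root_iff.2 hcross).1)

end FitsImpliesEq

theorem outcome_eq_iff_linkFits {x : T.Outcome} (hx : x ∈ T.OmegaAt T.C) :
    T.outcome ω = x ↔ ω T.CD = true ∧ ∀ j ∈ T.outerNodes, T.LinkFits x j ω := by
  obtain ⟨ω₀, rfl⟩ := mem_Omega.1 (OmegaAt_subset_Omega _ hx)
  constructor
  · intro h
    rw [← h] at hx ⊢
    exact ⟨(crossed_C_iff.1 (outcome_mem_OmegaAt_iff.1 hx)).1,
      fun j hj => linkFits_outcome (mem_outerNodes.1 hj) ω⟩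
  · exact fun h => outcome_eq_of_linkFits h.2 h.1 (outcome_mem_OmegaAt_iff.1 hx)

theorem dependsOn_linkFits (x : T.Outcome) (j : V) :
    DependsOn (T.LinkFits x j) (T.fittedLinks x j) := by
  unfold fittedLinks LinkFits
  split_ifs with hj hk
  · simp only [hj, not_true_eq_false, true_imp_iff, false_imp_iff, and_true]
    exact dependsOn_apply_inwardLink j
  · simp only [hj, hk, not_false_eq_true, true_imp_iff, false_imp_iff, true_and]
    exact fun _ _ h => congrArg Not (dependsOn_inwardLink_and_reachesLeaf j h)
  · simp only [hj, hk, not_false_eq_true, true_imp_iff, false_imp_iff, true_and]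
    exact fun _ _ _ => rfl

theorem bernoulliProb_linkFits (α : T.E → ℝ) (x : T.Outcome) (j : V) :
    bernoulliProb α (T.LinkFits x j) =
      if x ∈ T.OmegaAt j then α (T.inwardLink j)
      else if x ∈ T.OmegaAt (T.inward j) then 1 - α (T.inwardLink j) * T.reachesLeafProb α j
      else 1 := by
  unfold LinkFits
  split_ifs with hj hk
  · simp only [hj, not_true_eq_false, true_imp_iff, false_imp_iff, and_true]
    exact bernoulliProb_apply α _
  · simp only [hj, hk, not_false_eq_true, true_imp_iff, false_imp_iff, true_and]
    rw [bernoulliProb_not, bernoulliProb_inwardLink_and_reachesLeaf]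
  · simp only [hj, hk, not_false_eq_true, true_imp_iff, false_imp_iff, true_and]
    exact bernoulliProb_eq_one α fun _ => trivial

theorem CD_notMem_fittedLinks (x : T.Outcome) (h : T.Outward k j) : T.CD ∉ T.fittedLinks x j := by
  unfold fittedLinks
  split_ifs
  · exact (inwardLink_ne_CD h).symm
  · exact fun hCD => hCD.elim (inwardLink_ne_CD h).symm CD_notMem_linksBehind
  · exact Set.notMem_empty _

theorem not_behind_of_mem_OmegaAt_inward {x : T.Outcome} (hj : x ∈ T.OmegaAt (T.inward j))
    (hk : x ∉ T.OmegaAt k) (hne : j ≠ k) : ¬ T.Behind k j := by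
  intro h
  obtain ⟨p, hkp, hpj⟩ := (ReflTransGen.cases_tail h).resolve_left hne
  exact hk (OmegaAt_subset_of_behind hkp (hpj.2.2 ▸ hj))

theorem pairwiseDisjoint_fittedLinks (x : T.Outcome) :
    (T.outerNodes : Set V).PairwiseDisjoint (T.fittedLinks x) := by
  intro j hj k hk hne
  have hj := mem_outerNodes.1 hj
  have hk := mem_outerNodes.1 hk
  simp only [Function.onFun, fittedLinks]
  split_ifs with hxj hxk hxk' hxj' hxk hxk'
  · exact Set.disjoint_singleton.2 (mt (inwardLink_eq_iff hk).1 hne)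
  · rw [Set.disjoint_singleton_left, inwardLink_mem_insert_linksBehind_iff hj]
    exact fun h => hxk (OmegaAt_subset_of_behind h hxj)
  · exact Set.disjoint_empty _
  · rw [Set.disjoint_singleton_right, inwardLink_mem_insert_linksBehind_iff hk]
    exact fun h => hxj (OmegaAt_subset_of_behind h hxk)
  · refine disjoint_insert_linksBehind hj hk fun i hi hi' => ?_
    rcases hi.total hi' with h | h
    · exact not_behind_of_mem_OmegaAt_inward hxk' hxj hne.symm h
    · exact not_behind_of_mem_OmegaAt_inward hxj' hxk hne h
  · exact Set.disjoint_empty _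
  · exact Set.empty_disjoint _
  · exact Set.empty_disjoint _
  · exact Set.empty_disjoint _

theorem prob_eq_bernoulliProb (α : T.E → ℝ) (x : T.Outcome) :
    T.prob α x = bernoulliProb α fun ω => T.outcome ω = x := by
  rw [bernoulliProb_eq_sum_filter, Finset.sum_filter]
  rfl

theorem prob_eq_prod (α : T.E → ℝ) {x : T.Outcome} (hx : x ∈ T.OmegaAt T.C) :
    T.prob α x = α T.CD * ∏ j ∈ T.outerNodes,
      if x ∈ T.OmegaAt j then α (T.inwardLink j)
      else if x ∈ T.OmegaAt (T.inward j) then 1 - α (T.inwardLink j) * T.reachesLeafProb α j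
      else 1 := by
  have hCD : DependsOn (fun ω : T.E → Bool => ω T.CD = true) {T.CD} :=
    inwardLink_C (T := T) ▸ dependsOn_apply_inwardLink T.C
  have hfits : DependsOn (fun ω => ∀ j ∈ T.outerNodes, T.LinkFits x j ω) {T.CD}ᶜ :=
    fun _ _ h => propext <| forall₂_congr fun j hj => iff_of_eq <| dependsOn_linkFits x j
      fun e he => h e fun heCD =>
        CD_notMem_fittedLinks x (mem_outerNodes.1 hj) (Set.mem_singleton_iff.1 heCD ▸ he)
  simp only [prob_eq_bernoulliProb, outcome_eq_iff_linkFits hx]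
  rw [bernoulliProb_and α hCD hfits disjoint_compl_right, bernoulliProb_apply,
    bernoulliProb_forall α (fun j _ => dependsOn_linkFits x j) (pairwiseDisjoint_fittedLinks x)]
  simp only [bernoulliProb_linkFits]

end OutcomeProbability

end Probabilities

section AllWorking

variable [Finite V]

theorem reachesLeaf_true (k : V) : T.ReachesLeaf (fun _ => true) k := by
  obtain ⟨l, hl, hkl⟩ := exists_isLeaf_behind k
  exact ⟨l, hl, ReflTransGen.mono (fun _ _ h => ⟨h, rfl⟩) k l hkl⟩

theorem joined_true (k : V) : T.Joined (fun _ => true) k := by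
  induction k using outward_induction (T := T) with
  | hroot k => exact joined_root_iff.2 ⟨rfl, reachesLeaf_true _⟩
  | houtward k j hkj ih => exact (joined_iff_of_outward hkj).2 ⟨rfl, ih⟩

theorem crossed_true (k : V) : T.Crossed (fun _ => true) k :=
  ⟨joined_true k, reachesLeaf_true k⟩

theorem exists_crossed_not_crossed (h : T.Outward k j) :
    ∃ ω, T.Crossed ω k ∧ ¬ T.Crossed ω j := by
  classical
  let ω : T.E → Bool := fun e => decide (e ≠ T.inwardLink j)
  have agree : ∀ A : Set T.E, T.inwardLink j ∉ A → ∀ e ∈ A, true = ω e := fun A hA e he =>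
    (decide_eq_true (ne_of_mem_of_not_mem he hA)).symm
  obtain ⟨j', hj', hne⟩ := Set.exists_ne_of_one_lt_ncard
    (two_le_ncard_outward fun hk : T.IsLeaf k => hk j h) j
  have hjoined : T.Joined ω k := (dependsOn_joined k (agree _ fun hj =>
    hj (inwardLink_mem_linksBehind h))).mp (joined_true k)
  have hreach : T.ReachesLeaf ω j' := (dependsOn_reachesLeaf j' (agree _ fun hj =>
    hne (eq_of_outward_of_behind hj' h
      ((inwardLink_mem_linksBehind_iff h).1 hj).to_reflTransGen .refl))).mp (reachesLeaf_true j')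
  refine ⟨ω, ⟨hjoined, (reachesLeaf_iff fun hk => hk j h).2 ⟨j', hj', ?_, hreach⟩⟩, fun hj => ?_⟩
  · exact decide_eq_true (mt (inwardLink_eq_iff h).1 hne)
  · exact of_decide_eq_true ((joined_iff_of_outward h).1 hj.1).1 rfl

end AllWorking

noncomputable section Crossings

open scoped Classical

variable [Fintype V] {α : T.E → ℝ}

section CrossingTotal

theorem zero_mem_Omega : (0 : T.Outcome) ∈ T.Omega := by
  refine mem_Omega.2 ⟨fun _ => false, ?_⟩
  by_contra h
  have hC := mem_OmegaAt_C_iff.2 ⟨outcome_mem_Omega (T := T) fun _ => false, h⟩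
  exact Bool.false_ne_true (crossed_C_iff.1 (outcome_mem_OmegaAt_iff.1 hC)).1

theorem OmegaAt_nonempty (k : V) : (T.OmegaAt k).Nonempty :=
  ⟨_, outcome_mem_OmegaAt_iff.2 (crossed_true k)⟩

theorem OmegaAt_ssubset_of_outward (h : T.Outward k j) : T.OmegaAt j ⊂ T.OmegaAt k := by
  obtain ⟨ω, hk, hj⟩ := exists_crossed_not_crossed h
  exact (Finset.ssubset_iff_of_subset (OmegaAt_subset_of_behind (.single h))).2
    ⟨T.outcome ω, outcome_mem_OmegaAt_iff.2 hk, mt outcome_mem_OmegaAt_iff.1 hj⟩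

theorem exists_mem_OmegaAt_of_mem {x : T.Outcome} (hk : ¬ T.IsLeaf k) (hx : x ∈ T.OmegaAt k) :
    ∃ j ∈ T.outwardNbrs k, x ∈ T.OmegaAt j := by
  obtain ⟨ω, rfl⟩ := mem_Omega.1 (OmegaAt_subset_Omega k hx)
  obtain ⟨hjoined, hreach⟩ := outcome_mem_OmegaAt_iff.1 hx
  obtain ⟨j, hj, hω, hreach⟩ := (reachesLeaf_iff hk).1 hreach
  exact ⟨j, mem_outwardNbrs.2 hj, outcome_mem_OmegaAt_iff.2
    ⟨(joined_iff_of_outward hj).2 ⟨hω, hjoined⟩, hreach⟩⟩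

variable (T) in
/-- The total weight of the outcomes that show that a probe passed through `k`. For the weights
`p̂` this is the observed proportion `γ̂_k`. -/
def crossingTotal (w : T.Outcome → ℝ) (k : V) : ℝ := ∑ x ∈ T.OmegaAt k, w x

variable {w : T.Outcome → ℝ}

theorem crossingTotal_congr {w' : T.Outcome → ℝ} (h : Set.EqOn w w' T.Omega) :
    T.crossingTotal w = T.crossingTotal w' :=
  funext fun k => Finset.sum_congr rfl fun _ hx => h (OmegaAt_subset_Omega k hx)

theorem crossingTotal_root (w : T.Outcome → ℝ) (k : V) :
    T.crossingTotal w (T.root k) = T.crossingTotal w T.C := by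
  rw [crossingTotal, OmegaAt_root, crossingTotal]

theorem crossingTotal_D (w : T.Outcome → ℝ) : T.crossingTotal w T.D = T.crossingTotal w T.C := by
  rw [← root_D, crossingTotal_root]

theorem sum_Omega_eq (w : T.Outcome → ℝ) :
    ∑ x ∈ T.Omega, w x = w 0 + T.crossingTotal w T.C := by
  have hOmega : T.Omega = insert 0 (T.OmegaAt T.C) := by
    ext x
    rw [Finset.mem_insert, mem_OmegaAt_C_iff]
    exact ⟨fun hx => (eq_or_ne x 0).imp_right fun h => ⟨hx, h⟩,
      fun hx => hx.elim (fun h => h ▸ zero_mem_Omega) And.left⟩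
  rw [hOmega, Finset.sum_insert fun h => (mem_OmegaAt_C_iff.1 h).2 rfl, crossingTotal]

theorem crossingTotal_pos (hw : ∀ x ∈ T.Omega, 0 < w x) (k : V) : 0 < T.crossingTotal w k :=
  Finset.sum_pos (fun x hx => hw x (OmegaAt_subset_Omega k hx)) (OmegaAt_nonempty k)

theorem crossingTotal_lt_of_outward (hw : ∀ x ∈ T.Omega, 0 < w x) (h : T.Outward k j) :
    T.crossingTotal w j < T.crossingTotal w k := by
  obtain ⟨x, hx, hxj⟩ := Finset.exists_of_ssubset (OmegaAt_ssubset_of_outward h)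
  exact Finset.sum_lt_sum_of_subset (OmegaAt_ssubset_of_outward h).subset hx hxj
    (hw x (OmegaAt_subset_Omega k hx)) fun y hy _ => (hw y (OmegaAt_subset_Omega k hy)).le

theorem crossingTotal_lt_sum (hw : ∀ x ∈ T.Omega, 0 < w x) (hk : ¬ T.IsLeaf k) :
    T.crossingTotal w k < ∑ j ∈ T.outwardNbrs k, T.crossingTotal w j := by
  let crossedNbrs (x : T.Outcome) : Finset V := {j ∈ T.outwardNbrs k | x ∈ T.OmegaAt j}
  have hsum : ∑ j ∈ T.outwardNbrs k, T.crossingTotal w j =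
      ∑ x ∈ T.OmegaAt k, (crossedNbrs x).card * w x := by
    simp only [crossingTotal, ← nsmul_eq_mul, ← Finset.sum_const]
    refine Finset.sum_comm' fun j x => ?_
    simp only [crossedNbrs, Finset.mem_filter, mem_outwardNbrs]
    exact ⟨fun ⟨hj, hx⟩ => ⟨⟨hj, hx⟩, OmegaAt_subset_of_behind (.single hj) hx⟩, And.left⟩
  have hpos : ∀ x ∈ T.OmegaAt k, 0 < w x := fun x hx => hw x (OmegaAt_subset_Omega k hx)
  rw [hsum]
  refine Finset.sum_lt_sum (fun x hx => le_mul_of_one_le_left (hpos x hx).le ?_)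
    ⟨T.outcome fun _ => true, outcome_mem_OmegaAt_iff.2 (crossed_true k),
      lt_mul_of_one_lt_left (hpos _ (outcome_mem_OmegaAt_iff.2 (crossed_true k))) ?_⟩
  · obtain ⟨j, hj, hxj⟩ := exists_mem_OmegaAt_of_mem hk hx
    exact Nat.one_le_cast.2 (Finset.card_pos.2 ⟨j, Finset.mem_filter.2 ⟨hj, hxj⟩⟩)
  · have hall : crossedNbrs (T.outcome fun _ => true) = T.outwardNbrs k :=
      Finset.filter_true_of_mem fun j _ => outcome_mem_OmegaAt_iff.2 (crossed_true j)
    rw [hall]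
    exact Nat.one_lt_cast.2 (two_le_card_outwardNbrs hk)

theorem crossingAdmissible_crossingTotal (hw : ∀ x ∈ T.Omega, 0 < w x) (hk : ¬ T.IsLeaf k) :
    CrossingAdmissible (T.crossingTotal w k) (T.outwardNbrs k) (T.crossingTotal w) where
  pos := crossingTotal_pos hw k
  pos_of_mem _ _ := crossingTotal_pos hw _
  lt_of_mem _ hj := crossingTotal_lt_of_outward hw (mem_outwardNbrs.1 hj)
  lt_sum := crossingTotal_lt_sum hw hk

theorem crossingTotal_prob (α : T.E → ℝ) : T.crossingTotal (T.prob α) = T.crossedProb α := by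
  ext k
  simp only [crossingTotal, prob_eq_bernoulliProb, sum_bernoulliProb_eq, outcome_mem_OmegaAt_iff,
    crossedProb]

theorem sum_prob (α : T.E → ℝ) : ∑ x ∈ T.Omega, T.prob α x = 1 := by
  simp only [prob_eq_bernoulliProb, sum_bernoulliProb_eq]
  exact bernoulliProb_eq_one α outcome_mem_Omega

theorem prob_zero (α : T.E → ℝ) : T.prob α 0 = 1 - T.crossedProb α T.C := by
  rw [← sum_prob α, sum_Omega_eq, crossingTotal_prob, add_sub_cancel_right]

end CrossingTotal

section Param

theorem reachesLeafProb_pos (hα : α ∈ T.Param) (k : V) : 0 < T.reachesLeafProb α k :=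
  bernoulliProb_pos (fun e => (hα e).1) (fun e => (hα e).2) (reachesLeaf_true k)

theorem reachesLeafProb_le_one (hα : α ∈ T.Param) (k : V) : T.reachesLeafProb α k ≤ 1 :=
  bernoulliProb_le_one (fun e => (hα e).1.le) (fun e => (hα e).2) _

theorem joinedProb_pos (hα : α ∈ T.Param) (k : V) : 0 < T.joinedProb α k :=
  bernoulliProb_pos (fun e => (hα e).1) (fun e => (hα e).2) (joined_true k)

theorem prob_nonneg (hα : α ∈ T.Param) (x : T.Outcome) : 0 ≤ T.prob α x := by
  rw [prob_eq_bernoulliProb]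
  exact bernoulliProb_nonneg (fun e => (hα e).1.le) (fun e => (hα e).2) _

theorem isCrossingRoot_joinedProb (hα : α ∈ T.Param) (hk : ¬ T.IsLeaf k) :
    IsCrossingRoot (T.crossedProb α k) (T.outwardNbrs k) (T.crossedProb α)
      (T.joinedProb α k) := by
  have hA := (joinedProb_pos hα k).ne'
  refine ⟨?_, ?_⟩
  · rw [crossedProb_eq_mul]
    exact mul_le_of_le_one_right (joinedProb_pos hα k).le (reachesLeafProb_le_one hα k)
  · rw [crossedProb_eq_mul, mul_div_cancel_left₀ _ hA, one_sub_reachesLeafProb α hk]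
    refine Finset.prod_congr rfl fun j hj => ?_
    rw [crossedProb_of_outward α (mem_outwardNbrs.1 hj), mul_div_cancel_left₀ _ hA]

theorem joinedProb_mul_joinedProb_div_crossedProb (hα : α ∈ T.Param) :
    T.joinedProb α T.C * T.joinedProb α T.D / T.crossedProb α T.C = α T.CD := by
  rw [crossedProb_eq_mul, mul_div_mul_left _ _ (joinedProb_pos hα T.C).ne', joinedProb_D,
    mul_div_cancel_right₀ _ (reachesLeafProb_pos hα T.C).ne']

end Param

end Crossings

/-! ### The score -/

noncomputable section Score

open scoped Classical

variable [Fintype V] {α : T.E → ℝ} {w : T.Outcome → ℝ}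

theorem reachesLeafProb_congr {α' : T.E → ℝ} (k : V)
    (h : ∀ e ∈ T.linksBehind k, α e = α' e) : T.reachesLeafProb α k = T.reachesLeafProb α' k := by
  induction k using (wellFounded_outward_swap (T := T)).induction with
  | _ k ih =>
    by_cases hk : T.IsLeaf k
    · rw [reachesLeafProb_of_isLeaf hk, reachesLeafProb_of_isLeaf hk]
    · rw [← sub_right_inj (a := 1), one_sub_reachesLeafProb α hk, one_sub_reachesLeafProb α' hk]
      refine Finset.prod_congr rfl fun j hj => ?_
      have hkj := mem_outwardNbrs.1 hj
      rw [h _ (inwardLink_mem_linksBehind hkj),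
        ih j hkj fun e he => h e (linksBehind_subset hkj he)]

theorem reachesLeafProb_update {e : T.E} (h : e ∉ T.linksBehind k) (t : ℝ) :
    T.reachesLeafProb (Function.update α e t) k = T.reachesLeafProb α k :=
  reachesLeafProb_congr k fun _ he' => Function.update_of_ne (ne_of_mem_of_not_mem he' h) _ _

theorem crossedProb_C (α : T.E → ℝ) : T.crossedProb α T.C =
    α T.CD * (T.reachesLeafProb α T.D * T.reachesLeafProb α T.C) := by
  rw [crossedProb_eq_mul, joinedProb_C, mul_assoc]

variable (T) in
/-- The log-likelihood per observation of data in which the outcome `x` has the relative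
frequency `w x`. -/
def logLik (w : T.Outcome → ℝ) (α : T.E → ℝ) : ℝ :=
  ∑ x ∈ T.Omega, w x * Real.log (T.prob α x)

variable (T) in
/-- The contribution of the link inward of `j` to `logLik w α`. -/
def linkLogLik (w : T.Outcome → ℝ) (α : T.E → ℝ) (j : V) : ℝ :=
  T.crossingTotal w j * (Real.log (α (T.inwardLink j)) -
      Real.log (1 - α (T.inwardLink j) * T.reachesLeafProb α j)) +
    T.crossingTotal w (T.inward j) * Real.log (1 - α (T.inwardLink j) * T.reachesLeafProb α j)

theorem log_prob {x : T.Outcome} (hx : x ∈ T.OmegaAt T.C) (h : T.prob α x ≠ 0) :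
    Real.log (T.prob α x) = Real.log (α T.CD) + ∑ j ∈ T.outerNodes,
      ((if x ∈ T.OmegaAt j then Real.log (α (T.inwardLink j)) -
          Real.log (1 - α (T.inwardLink j) * T.reachesLeafProb α j) else 0) +
        if x ∈ T.OmegaAt (T.inward j) then
          Real.log (1 - α (T.inwardLink j) * T.reachesLeafProb α j) else 0) := by
  rw [prob_eq_prod α hx] at h ⊢
  obtain ⟨hCD, hprod⟩ := mul_ne_zero_iff.1 h
  rw [Real.log_mul hCD hprod, Real.log_prod fun j hj => Finset.prod_ne_zero_iff.1 hprod j hj]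
  refine congrArg _ (Finset.sum_congr rfl fun j hj => ?_)
  by_cases hxj : x ∈ T.OmegaAt j
  · have hxk := OmegaAt_subset_of_behind (.single (mem_outerNodes.1 hj)) hxj
    rw [if_pos hxj, if_pos hxj, if_pos hxk, sub_add_cancel]
  · rw [if_neg hxj, if_neg hxj, zero_add, apply_ite Real.log, Real.log_one]

theorem sum_mul_ite_mem_OmegaAt (w : T.Outcome → ℝ) (k : V) (c : ℝ) :
    ∑ x ∈ T.OmegaAt T.C, w x * (if x ∈ T.OmegaAt k then c else 0) = T.crossingTotal w k * c := by
  simp only [mul_ite, mul_zero]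
  rw [← Finset.sum_filter, Finset.filter_mem_eq_inter,
    Finset.inter_eq_right.2 (OmegaAt_subset_OmegaAt_C k), ← Finset.sum_mul, crossingTotal]

theorem logLik_eq (w : T.Outcome → ℝ) (h : ∀ x ∈ T.Omega, T.prob α x ≠ 0) :
    T.logLik w α = w 0 * Real.log (1 - T.crossedProb α T.C) +
      (T.crossingTotal w T.C * Real.log (α T.CD) + ∑ j ∈ T.outerNodes, T.linkLogLik w α j) := by
  have hC : ∑ x ∈ T.OmegaAt T.C, w x * Real.log (T.prob α x) =
      T.crossingTotal w T.C * Real.log (α T.CD) + ∑ j ∈ T.outerNodes, T.linkLogLik w α j := by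
    rw [Finset.sum_congr rfl fun x hx => by rw [log_prob hx (h x (OmegaAt_subset_Omega _ hx))]]
    simp only [mul_add, Finset.sum_add_distrib, Finset.mul_sum, linkLogLik]
    rw [Finset.sum_comm, Finset.sum_comm (s := T.OmegaAt T.C)]
    simp only [sum_mul_ite_mem_OmegaAt, crossingTotal, Finset.sum_mul]
  rw [logLik, sum_Omega_eq, prob_zero, crossingTotal, hC]

theorem logLik_eq_logLik {w' : T.Outcome → ℝ} (h : ∀ x ∈ T.Omega, T.prob α x ≠ 0)
    (hsum : ∑ x ∈ T.Omega, w x = ∑ x ∈ T.Omega, w' x)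
    (htotal : T.crossingTotal w = T.crossingTotal w') : T.logLik w α = T.logLik w' α := by
  rw [sum_Omega_eq, sum_Omega_eq, htotal, add_left_inj] at hsum
  simp only [logLik_eq _ h, linkLogLik, hsum, htotal]

theorem logLik_sub (w w' : T.Outcome → ℝ) (α : T.E → ℝ) :
    T.logLik (w - w') α = T.logLik w α - T.logLik w' α := by
  simp only [logLik, Pi.sub_apply, sub_mul, Finset.sum_sub_distrib]

theorem crossingTotal_sub (w w' : T.Outcome → ℝ) :
    T.crossingTotal (w - w') = T.crossingTotal w - T.crossingTotal w' := by
  ext k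
  simp only [crossingTotal, Pi.sub_apply, Finset.sum_sub_distrib]

theorem linkLogLik_update {e : T.E} (h : e ∉ insert (T.inwardLink j) (T.linksBehind j)) (t : ℝ) :
    T.linkLogLik w (Function.update α e t) j = T.linkLogLik w α j := by
  obtain ⟨hne, hbehind⟩ := not_or.1 h
  rw [linkLogLik, reachesLeafProb_update hbehind, Function.update_of_ne (Ne.symm hne), linkLogLik]

theorem differentiable_prob_update (α : T.E → ℝ) (e : T.E) (x : T.Outcome) :
    Differentiable ℝ fun t => T.prob (Function.update α e t) x := by
  simp only [prob_eq_bernoulliProb]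
  have hupdate : Differentiable ℝ (Function.update α e) := fun t =>
    (hasDerivAt_update α e t).differentiableAt
  exact (differentiable_bernoulliProb fun ω => T.outcome ω = x).comp hupdate

theorem eventually_prob_update_ne_zero (h : ∀ x ∈ T.Omega, T.prob α x ≠ 0) (e : T.E) :
    ∀ᶠ t in 𝓝 (α e), ∀ x ∈ T.Omega, T.prob (Function.update α e t) x ≠ 0 := by
  refine (Finset.eventually_all T.Omega).2 fun x hx =>
    (differentiable_prob_update α e x).continuous.continuousAt.eventually_ne ?_
  rw [Function.update_eq_self]
  exact h x hx

theorem hasDerivAt_logLik_prob (h : ∀ x ∈ T.Omega, T.prob α x ≠ 0) (e : T.E) :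
    HasDerivAt (fun t => T.logLik (T.prob α) (Function.update α e t)) 0 (α e) := by
  have hself := Function.update_eq_self e α
  have hscore := hasDerivAt_sum_mul_log (s := T.Omega) (t₀ := α e) (c := 1)
    (f := fun x t => T.prob (Function.update α e t) x)
    (fun x _ => differentiable_prob_update α e x _) (by rwa [hself]) fun t => sum_prob _
  rwa [hself] at hscore

theorem apply_mul_reachesLeafProb_lt_one (hα : α ∈ T.Param)
    (hpos : ∀ x ∈ T.Omega, 0 < T.prob α x) (h : T.Outward k j) :
    α (T.inwardLink j) * T.reachesLeafProb α j < 1 := by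
  refine lt_of_le_of_ne (mul_le_one₀ (hα _).2 (reachesLeafProb_pos hα j).le
    (reachesLeafProb_le_one hα j)) fun hone => ?_
  obtain ⟨x, hxk, hxj⟩ := Finset.exists_of_ssubset (OmegaAt_ssubset_of_outward h)
  have hprob := (hpos x (OmegaAt_subset_Omega k hxk)).ne'
  rw [prob_eq_prod α (OmegaAt_subset_OmegaAt_C k hxk)] at hprob
  have hfactor := Finset.prod_ne_zero_iff.1 (right_ne_zero_of_mul hprob) j h.mem_outerNodes
  rw [if_neg hxj, if_pos (h.2.2 ▸ hxk), hone, sub_self] at hfactor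
  exact hfactor rfl

theorem crossingTotal_C_eq_zero_of_hasDerivAt (hα : α ∈ T.Param)
    (hpos : ∀ x ∈ T.Omega, 0 < T.prob α x) (hw : ∑ x ∈ T.Omega, w x = 0)
    (hd : HasDerivAt (fun t => T.logLik w (Function.update α T.CD t)) 0 (α T.CD)) :
    T.crossingTotal w T.C = 0 := by
  have hlt : α T.CD * (T.reachesLeafProb α T.D * T.reachesLeafProb α T.C) < 1 := by
    rw [← crossedProb_C, ← sub_pos, ← prob_zero]
    exact hpos 0 zero_mem_Omega
  have hb := mul_pos (reachesLeafProb_pos hα T.D) (reachesLeafProb_pos hα T.C)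
  refine eq_zero_of_hasDerivAt_mul_log_sub_log (c := ∑ j ∈ T.outerNodes, T.linkLogLik w α j)
    (hα T.CD).1 hb.le hlt ?_ hd
  filter_upwards [eventually_prob_update_ne_zero (fun x hx => (hpos x hx).ne') T.CD] with t ht
  have hlink : ∀ j ∈ T.outerNodes,
      T.linkLogLik w (Function.update α T.CD t) j = T.linkLogLik w α j := fun j hj =>
    linkLogLik_update (not_or.2
      ⟨(inwardLink_ne_CD (mem_outerNodes.1 hj)).symm, CD_notMem_linksBehind⟩) t
  rw [sum_Omega_eq, ← eq_neg_iff_add_eq_zero] at hw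
  rw [logLik_eq w ht, Finset.sum_congr rfl hlink, crossedProb_C, Function.update_self,
    reachesLeafProb_update CD_notMem_linksBehind, reachesLeafProb_update CD_notMem_linksBehind, hw]
  ring

theorem crossingTotal_eq_zero_of_hasDerivAt_of_outward (hα : α ∈ T.Param)
    (hpos : ∀ x ∈ T.Omega, 0 < T.prob α x) (hw : w 0 = 0) (hkj : T.Outward k j)
    (htotal : ∀ i, T.Behind i k → T.crossingTotal w i = 0)
    (hd : HasDerivAt (fun t => T.logLik w (Function.update α (T.inwardLink j) t)) 0
      (α (T.inwardLink j))) :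
    T.crossingTotal w j = 0 := by
  have hC : T.crossingTotal w T.C = 0 := crossingTotal_root w k ▸ htotal _ (behind_root k)
  refine eq_zero_of_hasDerivAt_mul_log_sub_log (b := T.reachesLeafProb α j)
    (c := ∑ i ∈ T.outerNodes.erase j, T.linkLogLik w α i) (hα _).1 (reachesLeafProb_pos hα j).le
    (apply_mul_reachesLeafProb_lt_one hα hpos hkj) ?_ hd
  filter_upwards [eventually_prob_update_ne_zero (fun x hx => (hpos x hx).ne') (T.inwardLink j)]
    with t ht
  have hlink : ∀ i ∈ T.outerNodes.erase j,
      T.linkLogLik w (Function.update α (T.inwardLink j) t) i = T.linkLogLik w α i := by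
    intro i hi
    obtain ⟨hij, hi⟩ := Finset.mem_erase.1 hi
    by_cases hbehind : T.Behind i j
    · obtain ⟨p, hip, hpj⟩ := (ReflTransGen.cases_tail hbehind).resolve_left (Ne.symm hij)
      obtain rfl : p = k := hpj.2.2.symm.trans hkj.2.2
      have hinward := htotal _ (.head (mem_outerNodes.1 hi) hip)
      simp only [linkLogLik, htotal i hip, hinward, zero_mul, add_zero]
    · exact linkLogLik_update (mt (inwardLink_mem_insert_linksBehind_iff hkj).1 hbehind) t
  rw [logLik_eq w ht, hw, hC, ← Finset.add_sum_erase _ _ hkj.mem_outerNodes,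
    Finset.sum_congr rfl hlink, linkLogLik, hkj.2.2, htotal k .refl, Function.update_self,
    reachesLeafProb_update (inwardLink_notMem_linksBehind j)]
  ring

theorem crossingTotal_eq_zero_of_hasDerivAt (hα : α ∈ T.Param)
    (hpos : ∀ x ∈ T.Omega, 0 < T.prob α x) (hw : ∑ x ∈ T.Omega, w x = 0)
    (hd : ∀ e, HasDerivAt (fun t => T.logLik w (Function.update α e t)) 0 (α e)) :
    T.crossingTotal w = 0 := by
  have hC := crossingTotal_C_eq_zero_of_hasDerivAt hα hpos hw (hd T.CD)
  have hw0 : w 0 = 0 := by rwa [sum_Omega_eq, hC, add_zero] at hw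
  have hbehind : ∀ k i, T.Behind i k → T.crossingTotal w i = 0 := by
    refine outward_induction (T := T) (fun k i hi => ?_) fun k j hkj ih i hi => ?_
    · rcases ReflTransGen.cases_tail hi with hik | ⟨p, -, hp⟩
      · rw [← hik, crossingTotal_root, hC]
      · exact absurd hp not_outward_root
    · rcases ReflTransGen.cases_tail hi with rfl | ⟨p, hip, hpj⟩
      · exact crossingTotal_eq_zero_of_hasDerivAt_of_outward hα hpos hw0 hkj ih (hd _)
      · exact ih i (hkj.2.2 ▸ hpj.2.2 ▸ hip)
  exact funext fun k => hbehind k k .refl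

theorem hasDerivAt_logLik_of_crossedProb_eq (hpos : ∀ x ∈ T.Omega, 0 < T.prob α x)
    (hw : ∑ x ∈ T.Omega, w x = 1) (h : T.crossedProb α = T.crossingTotal w) (e : T.E) :
    HasDerivAt (fun t => T.logLik w (Function.update α e t)) 0 (α e) := by
  have hne : ∀ x ∈ T.Omega, T.prob α x ≠ 0 := fun x hx => (hpos x hx).ne'
  refine (hasDerivAt_logLik_prob hne e).congr_of_eventuallyEq ?_
  filter_upwards [eventually_prob_update_ne_zero hne e] with t ht
  exact logLik_eq_logLik ht (hw.trans (sum_prob α).symm) (h.symm.trans (crossingTotal_prob α).symm)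

theorem crossedProb_eq_of_hasDerivAt_logLik (hα : α ∈ T.Param)
    (hpos : ∀ x ∈ T.Omega, 0 < T.prob α x) (hw : ∑ x ∈ T.Omega, w x = 1)
    (hd : ∀ e, HasDerivAt (fun t => T.logLik w (Function.update α e t)) 0 (α e)) :
    T.crossedProb α = T.crossingTotal w := by
  have hsum : ∑ x ∈ T.Omega, (w - T.prob α) x = 0 := by
    simp only [Pi.sub_apply, Finset.sum_sub_distrib, hw, sum_prob, sub_self]
  have htotal := crossingTotal_eq_zero_of_hasDerivAt hα hpos hsum fun e => by
    simpa only [logLik_sub, sub_zero] using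
      (hd e).fun_sub (hasDerivAt_logLik_prob (fun x hx => (hpos x hx).ne') e)
  rw [crossingTotal_sub, sub_eq_zero, crossingTotal_prob] at htotal
  exact htotal.symm

end Score

/-! ### The closed-form estimates -/

noncomputable section Estimates

open scoped Classical

variable [Fintype V] {α : T.E → ℝ} {w : T.Outcome → ℝ} {γ : V → ℝ}

variable (T) in
/-- Conditions on positive numbers `γ k`, one for each node, under which link parameters with
crossing probabilities `γ` can be recovered from `γ`. -/
structure CrossingFeasible (γ : V → ℝ) : Prop where
  pos : ∀ k, 0 < γ k
  admissible : ∀ k, ¬ T.IsLeaf k → CrossingAdmissible (γ k) (T.outwardNbrs k) γ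
  apply_D : γ T.D = γ T.C

variable (T) in
/-- The value of `A_k` recovered from crossing probabilities `γ`: the closed-form estimate `Â_k` is
its value at the observed crossing proportions. -/
def joinedEstimate (γ : V → ℝ) (k : V) : ℝ :=
  if T.IsLeaf k then γ k else Classical.epsilon (IsCrossingRoot (γ k) (T.outwardNbrs k) γ)

variable (T) in
/-- The link parameters recovered from crossing probabilities `γ`: the closed-form estimate `α̂` is
their value at the observed crossing proportions. -/
def linkEstimate (γ : V → ℝ) (e : T.E) : ℝ :=
  if e = T.CD then T.joinedEstimate γ T.C * T.joinedEstimate γ T.D / γ T.C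
  else if T.Upper e.1.2 then T.joinedEstimate γ e.1.1 / T.joinedEstimate γ e.1.2
  else T.joinedEstimate γ e.1.2 / T.joinedEstimate γ e.1.1

theorem crossingFeasible_crossingTotal (hw : ∀ x ∈ T.Omega, 0 < w x) :
    T.CrossingFeasible (T.crossingTotal w) where
  pos := crossingTotal_pos hw
  admissible _ := crossingAdmissible_crossingTotal hw
  apply_D := crossingTotal_D w

theorem crossingFeasible_crossedProb (h : ∀ x ∈ T.Omega, 0 < T.prob α x) :
    T.CrossingFeasible (T.crossedProb α) :=
  crossingTotal_prob α ▸ crossingFeasible_crossingTotal h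

theorem joinedEstimate_of_isLeaf (γ : V → ℝ) (h : T.IsLeaf k) : T.joinedEstimate γ k = γ k :=
  if_pos h

theorem linkEstimate_CD (γ : V → ℝ) :
    T.linkEstimate γ T.CD = T.joinedEstimate γ T.C * T.joinedEstimate γ T.D / γ T.C :=
  if_pos rfl

theorem linkEstimate_inwardLink (γ : V → ℝ) (h : T.Outward p k) :
    T.linkEstimate γ (T.inwardLink k) = T.joinedEstimate γ k / T.joinedEstimate γ p := by
  rw [linkEstimate, if_neg (inwardLink_ne_CD h)]
  by_cases hk : T.Upper k
  · have hp := h.upper_iff.1 hk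
    simp only [inwardLink_of_upper hk, h.2.2, if_pos hp]
  · simp only [inwardLink_of_lower (lower_of_not_upper hk), h.2.2, if_neg hk]

namespace CrossingFeasible

theorem isCrossingRoot_joinedEstimate (h : T.CrossingFeasible γ) (hk : ¬ T.IsLeaf k) :
    IsCrossingRoot (γ k) (T.outwardNbrs k) γ (T.joinedEstimate γ k) := by
  rw [joinedEstimate, if_neg hk]
  exact Classical.epsilon_spec (h.admissible k hk).existsUnique.exists

theorem le_joinedEstimate (h : T.CrossingFeasible γ) (k : V) : γ k ≤ T.joinedEstimate γ k := by
  by_cases hk : T.IsLeaf k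
  · rw [joinedEstimate_of_isLeaf γ hk]
  · exact (h.isCrossingRoot_joinedEstimate hk).1

theorem joinedEstimate_pos (h : T.CrossingFeasible γ) (k : V) : 0 < T.joinedEstimate γ k :=
  (h.pos k).trans_le (h.le_joinedEstimate k)

theorem linkEstimate_pos (h : T.CrossingFeasible γ) : ∀ e, 0 < T.linkEstimate γ e := by
  refine forall_link_iff.2 ⟨?_, fun k j hkj => ?_⟩
  · rw [linkEstimate_CD]
    exact div_pos (mul_pos (h.joinedEstimate_pos _) (h.joinedEstimate_pos _)) (h.pos _)
  · rw [linkEstimate_inwardLink γ hkj]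
    exact div_pos (h.joinedEstimate_pos _) (h.joinedEstimate_pos _)

theorem reachesLeafProb_linkEstimate (h : T.CrossingFeasible γ) (k : V) :
    T.reachesLeafProb (T.linkEstimate γ) k = γ k / T.joinedEstimate γ k := by
  induction k using (wellFounded_outward_swap (T := T)).induction with
  | _ k ih =>
    by_cases hk : T.IsLeaf k
    · rw [reachesLeafProb_of_isLeaf hk, joinedEstimate_of_isLeaf γ hk, div_self (h.pos k).ne']
    · rw [← sub_right_inj (a := 1), one_sub_reachesLeafProb _ hk,
        (h.isCrossingRoot_joinedEstimate hk).2]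
      refine Finset.prod_congr rfl fun j hj => ?_
      have hkj := mem_outwardNbrs.1 hj
      rw [ih j hkj, linkEstimate_inwardLink γ hkj, div_mul_div_cancel₀'
        (h.joinedEstimate_pos j).ne']

theorem joinedProb_linkEstimate (h : T.CrossingFeasible γ) (k : V) :
    T.joinedProb (T.linkEstimate γ) k = T.joinedEstimate γ k := by
  have hne : ∀ k, T.joinedEstimate γ k ≠ 0 := fun k => (h.joinedEstimate_pos k).ne'
  have hγ := (h.pos T.C).ne'
  induction k using outward_induction (T := T) with
  | hroot k =>
    rcases root_eq_C_or_D k with hk | hk <;> rw [hk]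
    · rw [joinedProb_C, linkEstimate_CD, h.reachesLeafProb_linkEstimate, h.apply_D]
      field_simp [hne]
    · rw [joinedProb_D, linkEstimate_CD, h.reachesLeafProb_linkEstimate]
      field_simp [hne]
  | houtward k j hkj ih =>
    rw [joinedProb_of_outward _ hkj, ih, linkEstimate_inwardLink γ hkj, div_mul_cancel₀ _ (hne k)]

theorem crossedProb_linkEstimate (h : T.CrossingFeasible γ) :
    T.crossedProb (T.linkEstimate γ) = γ := by
  ext k
  rw [crossedProb_eq_mul, h.joinedProb_linkEstimate, h.reachesLeafProb_linkEstimate,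
    mul_div_cancel₀ _ (h.joinedEstimate_pos k).ne']

theorem continuousAt_joinedEstimate (h : T.CrossingFeasible γ) (k : V) :
    ContinuousAt (fun γ => T.joinedEstimate γ k) γ := by
  have hγ : ∀ j, Tendsto (fun γ' : V → ℝ => γ' j) (𝓝 γ) (𝓝 (γ j)) := fun j =>
    (continuous_apply j).tendsto γ
  by_cases hk : T.IsLeaf k
  · simpa only [ContinuousAt, joinedEstimate_of_isLeaf _ hk] using hγ k
  · have hadm := h.admissible k hk
    refine hadm.tendsto_root (hγ k) (fun j _ => hγ j) (h.isCrossingRoot_joinedEstimate hk) ?_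
    filter_upwards [hadm.eventually (hγ k) fun j _ => hγ j] with γ' hadm'
    rw [joinedEstimate, if_neg hk]
    exact Classical.epsilon_spec hadm'.existsUnique.exists

theorem continuousAt_linkEstimate (h : T.CrossingFeasible γ) :
    ContinuousAt T.linkEstimate γ := by
  have hest := h.continuousAt_joinedEstimate
  refine continuousAt_pi.2 (forall_link_iff.2 ⟨?_, fun k j hkj => ?_⟩)
  · simp only [linkEstimate_CD]
    exact ((hest T.C).mul (hest T.D)).div (continuous_apply T.C).continuousAt (h.pos T.C).ne'
  · simp only [linkEstimate_inwardLink _ hkj]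
    exact (hest j).div (hest k) (h.joinedEstimate_pos k).ne'

end CrossingFeasible

theorem joinedEstimate_crossedProb (hα : α ∈ T.Param) (h : T.CrossingFeasible (T.crossedProb α))
    (k : V) : T.joinedEstimate (T.crossedProb α) k = T.joinedProb α k := by
  by_cases hk : T.IsLeaf k
  · rw [joinedEstimate_of_isLeaf _ hk, crossedProb_of_isLeaf α hk]
  · exact (h.admissible k hk).existsUnique.unique (h.isCrossingRoot_joinedEstimate hk)
      (isCrossingRoot_joinedProb hα hk)

theorem linkEstimate_crossedProb (hα : α ∈ T.Param) (h : T.CrossingFeasible (T.crossedProb α)) :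
    T.linkEstimate (T.crossedProb α) = α := by
  refine funext (forall_link_iff.2 ⟨?_, fun k j hkj => ?_⟩)
  · simp only [linkEstimate_CD, joinedEstimate_crossedProb hα h,
      joinedProb_mul_joinedProb_div_crossedProb hα]
  · rw [linkEstimate_inwardLink _ hkj, joinedEstimate_crossedProb hα h,
      joinedEstimate_crossedProb hα h, joinedProb_of_outward α hkj,
      mul_div_cancel_right₀ _ (joinedProb_pos hα k).ne']

theorem prob_pos (hα : ∀ e, 0 < α e)
    (hlt : ∀ k j, T.Outward k j → α (T.inwardLink j) * T.reachesLeafProb α j < 1)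
    (hC : T.crossedProb α T.C < 1) {x : T.Outcome} (hx : x ∈ T.Omega) : 0 < T.prob α x := by
  by_cases h0 : x = 0
  · rw [h0, prob_zero]
    exact sub_pos.2 hC
  · rw [prob_eq_prod α (mem_OmegaAt_C_iff.2 ⟨hx, h0⟩)]
    refine mul_pos (hα _) (Finset.prod_pos fun j hj => ?_)
    split_ifs
    · exact hα _
    · exact sub_pos.2 (hlt _ j (mem_outerNodes.1 hj))
    · exact one_pos

theorem CrossingFeasible.prob_linkEstimate_pos (h : T.CrossingFeasible γ) (hC : γ T.C < 1)
    {x : T.Outcome} (hx : x ∈ T.Omega) : 0 < T.prob (T.linkEstimate γ) x := by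
  refine prob_pos h.linkEstimate_pos (fun k j hkj => ?_) (by rwa [h.crossedProb_linkEstimate]) hx
  have hlt := (h.admissible k fun hk => hk j hkj).lt_of_mem j (mem_outwardNbrs.2 hkj)
  rw [h.reachesLeafProb_linkEstimate, linkEstimate_inwardLink γ hkj,
    div_mul_div_cancel₀' (h.joinedEstimate_pos j).ne', div_lt_one (h.joinedEstimate_pos k)]
  exact hlt.trans_le (h.le_joinedEstimate k)

theorem prob_pos_of_lt_one (hα : ∀ e, 0 < α e ∧ α e < 1) {x : T.Outcome} (hx : x ∈ T.Omega) :
    0 < T.prob α x := by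
  have hparam : α ∈ T.Param := fun e => ⟨(hα e).1, (hα e).2.le⟩
  have hpos := reachesLeafProb_pos hparam
  have hle := reachesLeafProb_le_one hparam
  refine prob_pos (fun e => (hα e).1) (fun k j _ => ?_) ?_ hx
  · exact mul_lt_one_of_nonneg_of_lt_one_left (hα _).1.le (hα _).2 (hle j)
  · rw [crossedProb_C]
    exact mul_lt_one_of_nonneg_of_lt_one_left (hα _).1.le (hα _).2
      (mul_le_one₀ (hle _) (hpos _).le (hle _))

end Estimates

/-! ### Maximum likelihood -/

noncomputable section MaximumLikelihood

open scoped Classical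

variable [Fintype V] {n : T.Outcome → ℕ} {α α' : T.E → ℝ}

theorem Upper.gammaR_eq (hk : T.Upper k) : T.gammaR n k = T.crossingTotal (T.pHat n) k := by
  rw [gammaR, crossingTotal, OmegaAt_of_upper hk]

theorem Lower.gammaM_eq (hk : T.Lower k) : T.gammaM n k = T.crossingTotal (T.pHat n) k := by
  rw [gammaM, crossingTotal, OmegaAt_of_lower hk]

theorem Upper.isRootR_eq (hk : T.Upper k) : T.IsRootR n k =
    IsCrossingRoot (T.crossingTotal (T.pHat n) k) (T.outwardNbrs k)
      (T.crossingTotal (T.pHat n)) := by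
  have hparents : T.parents k = T.outwardNbrs k := by
    simp only [parents, outwardNbrs, hk.outward_iff]
  have hgamma : ∀ j ∈ T.outwardNbrs k, T.gammaR n j = T.crossingTotal (T.pHat n) j := fun j hj =>
    ((mem_outwardNbrs.1 hj).upper_iff.2 hk).gammaR_eq
  ext A
  rw [IsRootR, IsCrossingRoot, hparents, hk.gammaR_eq,
    Finset.prod_congr rfl fun j hj => by rw [hgamma j hj]]

theorem Lower.isRootM_eq (hk : T.Lower k) : T.IsRootM n k =
    IsCrossingRoot (T.crossingTotal (T.pHat n) k) (T.outwardNbrs k)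
      (T.crossingTotal (T.pHat n)) := by
  have hchildren : T.children k = T.outwardNbrs k := by
    simp only [children, outwardNbrs, hk.outward_iff]
  have hgamma : ∀ j ∈ T.outwardNbrs k, T.gammaM n j = T.crossingTotal (T.pHat n) j := fun j hj =>
    (lower_of_not_upper (mt (mem_outwardNbrs.1 hj).upper_iff.1 hk.not_upper)).gammaM_eq
  ext A
  rw [IsRootM, IsCrossingRoot, hchildren, hk.gammaM_eq,
    Finset.prod_congr rfl fun j hj => by rw [hgamma j hj]]

theorem Upper.AHatR_eq (hk : T.Upper k) :
    T.AHatR n k = T.joinedEstimate (T.crossingTotal (T.pHat n)) k := by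
  simp only [AHatR, joinedEstimate, hk.isLeaf_iff, hk.gammaR_eq, hk.isRootR_eq]

theorem Lower.AHatM_eq (hk : T.Lower k) :
    T.AHatM n k = T.joinedEstimate (T.crossingTotal (T.pHat n)) k := by
  simp only [AHatM, joinedEstimate, hk.isLeaf_iff, hk.gammaM_eq, hk.isRootM_eq]

theorem alphaHat_CD : T.alphaHat n T.CD = T.AHatR n T.C * T.AHatM n T.D / T.gammaR n T.C := by
  rw [alphaHat, if_pos rfl, alphaHatCD]

theorem alphaHat_eq_linkEstimate :
    T.alphaHat n = T.linkEstimate (T.crossingTotal (T.pHat n)) := by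
  refine funext (forall_link_iff.2 ⟨?_, fun k j hkj => ?_⟩)
  · rw [alphaHat_CD, linkEstimate_CD, upper_C.AHatR_eq, lower_D.AHatM_eq, upper_C.gammaR_eq]
  · rw [linkEstimate_inwardLink _ hkj, alphaHat, if_neg (inwardLink_ne_CD hkj)]
    by_cases hj : T.Upper j
    · have hk := hkj.upper_iff.1 hj
      simp only [inwardLink_of_upper hj, hkj.2.2, if_pos hk, hk.AHatR_eq, hj.AHatR_eq]
    · have hk := lower_of_not_upper (mt hkj.upper_iff.2 hj)
      have hj' := lower_of_not_upper hj
      simp only [inwardLink_of_lower hj', hkj.2.2, if_neg hj, hk.AHatM_eq, hj'.AHatM_eq]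

theorem sum_count_pos (hn : ∀ x ∈ T.Omega, 0 < n x) : 0 < ∑ x ∈ T.Omega, (n x : ℝ) :=
  Finset.sum_pos (fun x hx => Nat.cast_pos.2 (hn x hx)) ⟨0, zero_mem_Omega⟩

theorem pHat_pos (hn : ∀ x ∈ T.Omega, 0 < n x) : ∀ x ∈ T.Omega, 0 < T.pHat n x := fun x hx =>
  div_pos (Nat.cast_pos.2 (hn x hx)) (sum_count_pos hn)

theorem count_pos_of_pHat_pos {x : T.Outcome} (h : 0 < T.pHat n x) : 0 < n x := by
  refine Nat.pos_of_ne_zero fun h0 => h.ne' ?_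
  rw [pHat, h0, Nat.cast_zero, zero_div]

theorem sum_pHat (hn : ∀ x ∈ T.Omega, 0 < n x) : ∑ x ∈ T.Omega, T.pHat n x = 1 := by
  simp only [pHat, ← Finset.sum_div, div_self (sum_count_pos hn).ne']

theorem crossingTotal_pHat_C (hn : ∀ x ∈ T.Omega, 0 < n x) :
    T.crossingTotal (T.pHat n) T.C = 1 - T.pHat n 0 := by
  rw [← sum_pHat hn, sum_Omega_eq, add_sub_cancel_left]

theorem crossingFeasible_pHat (hn : ∀ x ∈ T.Omega, 0 < n x) :
    T.CrossingFeasible (T.crossingTotal (T.pHat n)) :=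
  crossingFeasible_crossingTotal (pHat_pos hn)

theorem logLikelihood_eq (hn : ∀ x ∈ T.Omega, 0 < n x) (α : T.E → ℝ) :
    T.logLikelihood n α = (∑ x ∈ T.Omega, (n x : ℝ)) * T.logLik (T.pHat n) α := by
  have hN := (sum_count_pos hn).ne'
  simp only [logLikelihood, logLik, pHat, Finset.mul_sum, ← mul_assoc, mul_div_cancel₀ _ hN]

theorem likelihood_eq_exp (hpos : ∀ x ∈ T.Omega, 0 < T.prob α x) :
    T.likelihood n α = Real.exp (T.logLikelihood n α) := by
  rw [likelihood, logLikelihood, Real.exp_sum]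
  exact Finset.prod_congr rfl fun x hx => by rw [Real.exp_nat_mul, Real.exp_log (hpos x hx)]

theorem prob_pos_of_likelihood_ne_zero (hn : ∀ x ∈ T.Omega, 0 < n x) (hα : α ∈ T.Param)
    (h : T.likelihood n α ≠ 0) : ∀ x ∈ T.Omega, 0 < T.prob α x := fun x hx =>
  (prob_nonneg hα x).lt_of_ne'
    ((pow_ne_zero_iff (hn x hx).ne').1 (Finset.prod_ne_zero_iff.1 h x hx))

/-- Every outcome of `Ω` has positive probability at `α`, and the crossing probability of every node
is the observed crossing proportion. When all counts are positive, these `α` are the solutions of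
the likelihood equation. -/
structure FitsCounts (n : T.Outcome → ℕ) (α : T.E → ℝ) : Prop where
  mem_param : α ∈ T.Param
  prob_pos : ∀ x ∈ T.Omega, 0 < T.prob α x
  crossedProb_eq : T.crossedProb α = T.crossingTotal (T.pHat n)

theorem solvesLikelihoodEq_iff_fitsCounts (hn : ∀ x ∈ T.Omega, 0 < n x) :
    T.SolvesLikelihoodEq n α ↔ T.FitsCounts n α := by
  have hN := (sum_count_pos hn).ne'
  constructor
  · intro ⟨hα, hpos, hd⟩
    refine ⟨hα, hpos, crossedProb_eq_of_hasDerivAt_logLik hα hpos (sum_pHat hn) fun e => ?_⟩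
    simpa only [logLikelihood_eq hn, inv_mul_cancel_left₀ hN, mul_zero] using
      (hd e).const_mul (∑ x ∈ T.Omega, (n x : ℝ))⁻¹
  · intro h
    refine ⟨h.mem_param, h.prob_pos, fun e => ?_⟩
    simpa only [logLikelihood_eq hn, mul_zero] using
      (hasDerivAt_logLik_of_crossedProb_eq h.prob_pos (sum_pHat hn) h.crossedProb_eq e).const_mul
        (∑ x ∈ T.Omega, (n x : ℝ))

theorem fitsCounts_alphaHat (hn : ∀ x ∈ T.Omega, 0 < n x) (h : ∀ e, T.alphaHat n e ≤ 1) :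
    T.FitsCounts n (T.alphaHat n) := by
  rw [alphaHat_eq_linkEstimate] at h ⊢
  have hfeas := crossingFeasible_pHat hn
  have hC : T.crossingTotal (T.pHat n) T.C < 1 := by
    rw [crossingTotal_pHat_C hn]
    exact sub_lt_self 1 (pHat_pos hn 0 zero_mem_Omega)
  exact ⟨fun e => ⟨hfeas.linkEstimate_pos e, h e⟩, fun x hx => hfeas.prob_linkEstimate_pos hC hx,
    hfeas.crossedProb_linkEstimate⟩

namespace FitsCounts

theorem alphaHat_eq (h : T.FitsCounts n α) : T.alphaHat n = α := by
  rw [alphaHat_eq_linkEstimate, ← h.crossedProb_eq]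
  exact linkEstimate_crossedProb h.mem_param (crossingFeasible_crossedProb h.prob_pos)

theorem apply_CD (h : T.FitsCounts n α) :
    α T.CD = T.AHatR n T.C * T.AHatM n T.D / T.gammaR n T.C := by
  rw [← alphaHat_CD, h.alphaHat_eq]

theorem logLikelihood_eq (hn : ∀ x ∈ T.Omega, 0 < n x) (h : T.FitsCounts n α)
    (hpos : ∀ x ∈ T.Omega, 0 < T.prob α' x) : T.logLikelihood n α' =
      (∑ x ∈ T.Omega, (n x : ℝ)) * ∑ x ∈ T.Omega, T.prob α x * Real.log (T.prob α' x) := by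
  rw [TreeNetwork.logLikelihood_eq hn, logLik_eq_logLik (fun x hx => (hpos x hx).ne')
    ((sum_pHat hn).trans (sum_prob α).symm)
    (h.crossedProb_eq.symm.trans (crossingTotal_prob α).symm), logLik]

theorem isMLE (hn : ∀ x ∈ T.Omega, 0 < n x) (h : T.FitsCounts n α) : T.IsMLE n α := by
  refine ⟨h.mem_param, fun α' hα' => ?_⟩
  change T.likelihood n α' ≤ T.likelihood n α
  by_cases h0 : T.likelihood n α' = 0
  · rw [h0, likelihood_eq_exp h.prob_pos]
    exact (Real.exp_pos _).le
  · have hpos := prob_pos_of_likelihood_ne_zero hn hα' h0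
    rw [likelihood_eq_exp hpos, likelihood_eq_exp h.prob_pos, Real.exp_le_exp,
      h.logLikelihood_eq hn hpos, h.logLikelihood_eq hn h.prob_pos]
    exact mul_le_mul_of_nonneg_left (sum_mul_log_le_sum_mul_log h.prob_pos hpos
      (by rw [sum_prob, sum_prob])) (sum_count_pos hn).le

theorem of_isMLE (hn : ∀ x ∈ T.Omega, 0 < n x) (h : T.FitsCounts n α) (h' : T.IsMLE n α') :
    T.FitsCounts n α' := by
  have hle : T.likelihood n α ≤ T.likelihood n α' := h'.2 h.mem_param
  have hpos := prob_pos_of_likelihood_ne_zero hn h'.1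
    ((likelihood_eq_exp h.prob_pos ▸ Real.exp_pos _).trans_le hle).ne'
  rw [likelihood_eq_exp hpos, likelihood_eq_exp h.prob_pos, Real.exp_le_exp,
    h.logLikelihood_eq hn hpos, h.logLikelihood_eq hn h.prob_pos] at hle
  have hprob : Set.EqOn (T.prob α') (T.prob α) T.Omega :=
    eqOn_of_sum_mul_log_le h.prob_pos hpos (by rw [sum_prob, sum_prob])
      (le_of_mul_le_mul_left hle (sum_count_pos hn))
  refine ⟨h'.1, hpos, ?_⟩
  rw [← h.crossedProb_eq, ← crossingTotal_prob, ← crossingTotal_prob]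
  exact crossingTotal_congr hprob

end FitsCounts

end MaximumLikelihood

/-! ### Asymptotics -/

noncomputable section Asymptotics

variable [Fintype V] {α : T.E → ℝ}

theorem continuous_crossingTotal : Continuous T.crossingTotal :=
  continuous_pi fun _ => continuous_finsetSum _ fun x _ => continuous_apply x

theorem eventually_linkEstimate_le_one (hα : ∀ e, 0 < α e ∧ α e < 1) :
    ∀ᶠ w in 𝓝 (T.prob α), ∀ e, T.linkEstimate (T.crossingTotal w) e ≤ 1 := by
  have hfeas := crossingFeasible_crossedProb fun x hx => prob_pos_of_lt_one hα hx
  have hcont := hfeas.continuousAt_linkEstimate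
  rw [← crossingTotal_prob] at hcont
  have htendsto := (hcont.comp continuous_crossingTotal.continuousAt).tendsto
  rw [Function.comp_apply, crossingTotal_prob,
    linkEstimate_crossedProb (fun e => ⟨(hα e).1, (hα e).2.le⟩) hfeas, tendsto_pi_nhds] at htendsto
  exact eventually_all.2 fun e =>
    ((htendsto e).eventually_lt_const (hα e).2).mono fun _ h => h.le

theorem exists_alphaHat_le_one (hα : ∀ e, 0 < α e ∧ α e < 1) :
    ∃ ε > 0, ∀ n : T.Outcome → ℕ, (∀ x ∈ T.Omega, |T.pHat n x - T.prob α x| < ε) →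
      (∀ x ∈ T.Omega, 0 < n x) ∧ ∀ e, T.alphaHat n e ≤ 1 := by
  have hpos : ∀ᶠ w in 𝓝 (T.prob α), ∀ x ∈ T.Omega, 0 < w x :=
    (Finset.eventually_all T.Omega).2 fun x hx =>
      (continuous_apply x).continuousAt.eventually_const_lt (prob_pos_of_lt_one hα hx)
  obtain ⟨ε, hε, h⟩ := exists_forall_abs_sub_lt_of_eventually_nhds (s := T.Omega)
    (hpos.and (eventually_linkEstimate_le_one hα)) fun w w' hww' hw =>
      ⟨fun x hx => hww' hx ▸ hw.1 x hx, crossingTotal_congr hww' ▸ hw.2⟩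
  refine ⟨ε, hε, fun n hn => ⟨fun x hx => count_pos_of_pHat_pos ((h _ hn).1 x hx), ?_⟩⟩
  rw [alphaHat_eq_linkEstimate]
  exact (h _ hn).2

end Asymptotics

end TreeNetwork

theorem mainTheorem9 {V : Type*} [Fintype V] (T : TreeNetwork V) :
    (∀ n : T.Outcome → ℕ, (∀ x ∈ T.Omega, 0 < n x) →
      T.gammaR n T.C = T.gammaM n T.D ∧
      T.gammaM n T.D = 1 - T.pHat n 0 ∧
      (∀ k, T.Upper k → ¬ T.IsSource k → ∃! A, T.IsRootR n k A) ∧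
      (∀ k, T.Lower k → ¬ T.IsReceiver k → ∃! A, T.IsRootM n k A) ∧
      (∀ α, T.SolvesLikelihoodEq n α →
        T.IsMLE n α ∧ α T.CD = T.AHatR n T.C * T.AHatM n T.D / T.gammaR n T.C) ∧
      ((∀ e, T.alphaHat n e ≤ 1) →
        T.SolvesLikelihoodEq n (T.alphaHat n) ∧
        T.IsMLE n (T.alphaHat n) ∧
        ∀ α, T.IsMLE n α →
          α T.CD = T.AHatR n T.C * T.AHatM n T.D / T.gammaR n T.C)) ∧
    (∀ α : T.E → ℝ, (∀ e, 0 < α e ∧ α e < 1) →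
      ∃ ε > 0, ∀ n : T.Outcome → ℕ, (∀ x ∈ T.Omega, |T.pHat n x - T.prob α x| < ε) →
        (∀ x ∈ T.Omega, 0 < n x) ∧ ∀ e, T.alphaHat n e ≤ 1) := by
  refine ⟨fun n hn => ?_, fun α hα => TreeNetwork.exists_alphaHat_le_one hα⟩
  have hfeas := TreeNetwork.crossingFeasible_pHat hn
  have hfits α := TreeNetwork.solvesLikelihoodEq_iff_fitsCounts (α := α) hn
  have hC := TreeNetwork.upper_C.gammaR_eq (n := n)
  have hD := TreeNetwork.lower_D.gammaM_eq (n := n)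
  refine ⟨?_, ?_, fun k hk hs => ?_, fun k hk hr => ?_, fun α h => ?_, fun h => ?_⟩
  · rw [hC, hD, hfeas.apply_D]
  · rw [hD, hfeas.apply_D, TreeNetwork.crossingTotal_pHat_C hn]
  · rw [hk.isRootR_eq]
    exact (hfeas.admissible k (mt hk.isLeaf_iff.1 hs)).existsUnique
  · rw [hk.isRootM_eq]
    exact (hfeas.admissible k (mt hk.isLeaf_iff.1 hr)).existsUnique
  · have hfit := (hfits α).1 h
    exact ⟨hfit.isMLE hn, hfit.apply_CD⟩
  · have hfit := TreeNetwork.fitsCounts_alphaHat hn h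
    exact ⟨(hfits _).2 hfit, hfit.isMLE hn, fun α hα => (hfit.of_isMLE hn hα).apply_CD⟩
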